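/- **Setting.** Let $\mathcal K$ (strikes) and $\mathcal T$ (maturities) be finite sets; all sums over $(k,\tau)$ run over $\mathcal K\times\mathcal T$. Let $T,\sigma,C,\gamma,\eta>0$, $\omega\in[0,1)$, $\overline q\in\mathbb N$, and for each $(k,\tau)$ let $\Delta^{k,\tau}\in(0,1)$, $c^{k,\tau}\ge 0$ and $f^{k,\tau},\delta_\infty^{k,\tau}\in\mathbb R$. Put $\phi(a)=1$, $\phi(b)=-1$ and $$\tilde C:=\frac{C\gamma\eta}{\gamma+\eta}\,\frac{\sigma}{2(1-\omega)},\qquad \hat C^{k,\tau}:=\tilde C^{k,\tau}\,\frac{C}{\sigma\eta(1-\omega)},$$ where, with $\alpha=\eta(1-\omega)+\frac C\sigma$ and $\beta=\frac C\sigma$, $$\tilde C^{k,\tau}:=x_2\Big(\frac{x_2}{x_1^{k,\tau}}\Big)^{\frac{\alpha}{\alpha-\beta}}O_{k,\tau}\Big(\big(\tfrac{\beta}{\alpha}\big)^{\frac{\beta}{\alpha-\beta}}-\big(\tfrac{\beta}{\alpha}\big)^{\frac{\alpha}{\alpha-\beta}}\Big),\qquad x_2=1+\eta\,\frac{1-(1+\frac{\sigma\gamma}{C})^{-1}}{\gamma},$$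 $$x_1^{k,\tau}=e^{-\eta\left(c^{k,\tau}+\omega\left(\delta_\infty^{k,\tau}-\gamma^{-1}\log(1+\frac{\sigma\gamma}{C})\right)\right)},\qquad O_{k,\tau}=\Big(1+\frac{\sigma\gamma}{C}\Big)^{-\frac{C}{\gamma\sigma}}e^{-\frac C\sigma f^{k,\tau}}.$$ **Lemma.** One has $\hat C^{k,\tau}>0$ for all $(k,\tau)$. Moreover, let $(R^{k,\tau})$ be any family of positive numbers (in particular one may take $R^{k,\tau}=\hat C^{k,\tau}$), and let $\tilde U$ be a bounded solution on $[0,T]\times\mathbb R$ of the linear equation $$0=\partial_t\tilde U(t,x)-\tilde C x^2\,\tilde U(t,x)+\sum_{i=a,b}\sum_{(k,\tau)}R^{k,\tau}\,\tilde U\big(t,x-\Delta^{k,\tau}\phi(i)\big)\mathbf 1_{\{\phi(i)x>-\overline q\}},\qquad \tilde U(T,x)=1 .$$ Let $t\in[0,T]$ and $q\in\mathbb R$. On a filtered probability space, let $\overline N^{k,\tau,i}$, $(k,\tau)\in\mathcal K\times\mathcal T$, $i\in\{a,b\}$, be adapted point processes on $[t,T]$ (right-continuous nondecreasing $\mathbb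 N$-valued paths with jumps of size $1$), almost surely without common jumps, such that, with $$\mathcal Q_s^{t,q}=q+\int_t^s\sum_{(k,\tau)}\Delta^{k,\tau}\,\mathrm d\big(\overline N_u^{k,\tau,b}-\overline N_u^{k,\tau,a}\big),\qquad s\in[t,T],$$ each $\overline N^{k,\tau,i}$ has intensity $\overline\lambda_s^{k,\tau,i}:=R^{k,\tau}\mathbf 1_{\{\phi(i)\mathcal Q^{t,q}_{s-}>-\overline q\}}$, that is, $\overline N^{k,\tau,i}_s-\overline N^{k,\tau,i}_t-\int_t^s\overline\lambda_u^{k,\tau,i}\,\mathrm du$, $s\in[t,T]$, is a martingale. Then $$\tilde U(t,q)=\mathbb E\bigg[\exp\Big(\int_t^T\Big(-\tilde C\big(\mathcal Q_s^{t,q}\big)^2+\sum_{i=a,b}\sum_{(k,\tau)}\overline\lambda_s^{k,\tau,i}\Big)\mathrm ds\Big)\bigg],$$ where the time integral is well defined for every path and the random variable inside the expectation is integrable. -/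

import Mathlib

open MeasureTheory ProbabilityTheory Set

noncomputable section

/-- The two sides of the book: ask orders and bid orders. -/
inductive Side : Type
  | ask : Side
  | bid : Side
  deriving DecidableEq

instance : Fintype Side where
  elems := {Side.ask, Side.bid}
  complete := by intro i; cases i <;> simp

/-- The sign `φ` of a side: `φ(ask) = 1`, `φ(bid) = -1`. -/
def Side.sgn : Side → ℝ
  | Side.ask => 1
  | Side.bid => -1

/-- The model parameters, for `n` strikes and `m` maturities; the options are indexed by the pairs
(strike, maturity) in `Fin n × Fin m`. -/
structure MarketModel (n m : ℕ) where
  /-- trading horizon -/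
  T : ℝ
  /-- volatility of the underlying -/
  σ : ℝ
  /-- decay parameter of the order arrival intensity -/
  C : ℝ
  /-- risk aversion of the market maker -/
  γ : ℝ
  /-- risk aversion of the exchange -/
  η : ℝ
  /-- weight of the spread penalty -/
  ω : ℝ
  /-- fee collected by the exchange on each option -/
  fee : Fin n × Fin m → ℝ
  /-- value that the exchange attributes to a trade on each option -/
  c : Fin n × Fin m → ℝ
  /-- spread threshold for each option -/
  δInf : Fin n × Fin m → ℝ
  /-- (constant) delta of each call option -/
  Δ : Fin n × Fin m → ℝ
  /-- critical absolute inventory -/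
  qBar : ℕ
  T_pos : 0 < T
  σ_pos : 0 < σ
  C_pos : 0 < C
  γ_pos : 0 < γ
  η_pos : 0 < η
  ω_nonneg : 0 ≤ ω
  ω_lt_one : ω < 1
  c_nonneg : ∀ j, 0 ≤ c j
  Δ_pos : ∀ j, 0 < Δ j
  Δ_lt_one : ∀ j, Δ j < 1

namespace MarketModel

variable {n m : ℕ} (M : MarketModel n m)

/-- `C̃ = (C γ η / (γ + η)) (σ / (2 (1 - ω)))`, the coefficient of the quadratic term. -/
def cTilde : ℝ := M.C * M.γ * M.η / (M.γ + M.η) * (M.σ / (2 * (1 - M.ω)))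

/-- `a = η (1 - ω) + C / σ`. -/
def aCst : ℝ := M.η * (1 - M.ω) + M.C / M.σ

/-- `b = C / σ`. -/
def bCst : ℝ := M.C / M.σ

/-- `x₁ = exp (-η (c + ω (δ_∞ - γ⁻¹ log (1 + σ γ / C))))`. -/
def x₁ (j : Fin n × Fin m) : ℝ :=
  Real.exp (-M.η * (M.c j + M.ω * (M.δInf j - M.γ⁻¹ * Real.log (1 + M.σ * M.γ / M.C))))

/-- `x₂ = 1 + η (1 - (1 + σ γ / C)⁻¹) / γ`. -/
def x₂ : ℝ := 1 + M.η * ((1 - (1 + M.σ * M.γ / M.C)⁻¹) / M.γ)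

/-- `O = (1 + σ γ / C) ^ (-C / (γ σ)) exp (-(C / σ) f)`. -/
def oCst (j : Fin n × Fin m) : ℝ :=
  (1 + M.σ * M.γ / M.C) ^ (-(M.C / (M.γ * M.σ))) * Real.exp (-(M.C / M.σ) * M.fee j)

/-- `C̃^{k,τ} = x₂ (x₂ / x₁) ^ (a / (a - b)) O ((b / a) ^ (b / (a - b)) - (b / a) ^ (a / (a - b)))`. -/
def cTildeOpt (j : Fin n × Fin m) : ℝ :=
  M.x₂ * (M.x₂ / M.x₁ j) ^ (M.aCst / (M.aCst - M.bCst)) * M.oCst j *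
    ((M.bCst / M.aCst) ^ (M.bCst / (M.aCst - M.bCst))
      - (M.bCst / M.aCst) ^ (M.aCst / (M.aCst - M.bCst)))

/-- `Ĉ^{k,τ} = C̃^{k,τ} C / (σ η (1 - ω))`. -/
def cHat (j : Fin n × Fin m) : ℝ :=
  M.cTildeOpt j * (M.C / (M.σ * M.η * (1 - M.ω)))

/-- The inventory constraint `1_{φ(i) x > -q̄}`: an order on side `i` may arrive at inventory `x`. -/
def allowed (i : Side) (x : ℝ) : ℝ := if i.sgn * x > -(M.qBar : ℝ) then 1 else 0

/-- `U` is a bounded (classical) solution on `[0, T] × ℝ` of the linear equation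
`0 = ∂ₜU(t,x) - C̃ x² U(t,x) + ∑ᵢ ∑_{k,τ} R^{k,τ} U(t, x - Δ^{k,τ} φ(i)) 1_{φ(i) x > -q̄}`
with terminal value `U(T, x) = 1`. At `t = 0` and `t = T` the time derivative is one-sided. -/
structure IsBoundedSolution (R : Fin n × Fin m → ℝ) (U : ℝ → ℝ → ℝ) : Prop where
  bounded : ∃ B : ℝ, ∀ t ∈ Icc 0 M.T, ∀ x : ℝ, |U t x| ≤ B
  equation : ∀ t ∈ Icc 0 M.T, ∀ x : ℝ, ∃ dU : ℝ,
    HasDerivWithinAt (fun s => U s x) dU (Icc 0 M.T) t ∧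
    0 = dU - U t x * M.cTilde * x ^ 2
        + ∑ i : Side, ∑ j : Fin n × Fin m, R j * U t (x - M.Δ j * i.sgn) * M.allowed i x
  terminal : ∀ x : ℝ, U M.T x = 1

variable {Ω : Type*}

/-- The delta-weighted inventory started from `q` at time `t`:
`𝒬_s = q + ∫_{(t,s]} ∑_{k,τ} Δ^{k,τ} d(N^{k,τ,b} - N^{k,τ,a})`. -/
def inventory (t q : ℝ) (N : Fin n × Fin m → Side → ℝ → Ω → ℕ) (s : ℝ) (ω : Ω) : ℝ :=
  q + ∑ j : Fin n × Fin m, M.Δ j *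
    (((N j Side.bid s ω : ℝ) - (N j Side.bid t ω : ℝ))
      - ((N j Side.ask s ω : ℝ) - (N j Side.ask t ω : ℝ)))

/-- The intensity `λ_s^{k,τ,i} = R^{k,τ} 1_{φ(i) 𝒬_{s-} > -q̄}`, with `𝒬_{s-}` the left limit of the
inventory at time `s`. It is used for `s ∈ (t, T]` only (up to a Lebesgue null set of times). -/
def intensity (R : Fin n × Fin m → ℝ) (t q : ℝ) (N : Fin n × Fin m → Side → ℝ → Ω → ℕ)
    (j : Fin n × Fin m) (i : Side) (s : ℝ) (ω : Ω) : ℝ :=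
  R j * M.allowed i (Function.leftLim (fun u => M.inventory t q N u ω) s)

/-- The integrand of the representation, `-C̃ 𝒬_s² + ∑ᵢ ∑_{k,τ} λ_s^{k,τ,i}`. -/
def rate (R : Fin n × Fin m → ℝ) (t q : ℝ) (N : Fin n × Fin m → Side → ℝ → Ω → ℕ)
    (s : ℝ) (ω : Ω) : ℝ :=
  -M.cTilde * (M.inventory t q N s ω) ^ 2
    + ∑ i : Side, ∑ j : Fin n × Fin m, M.intensity R t q N j i s ω

/-- On the filtered probability space `(Ω, ℱ, μ)`, the `N j i`, observed on `[t, T]`, are point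
processes (counting processes with unit jumps, almost surely without common jumps), adapted to `ℱ`,
and `N j i` has the `ℱ`-intensity `λ^{j,i}`: `N j i - ∫ λ^{j,i} ds` is an `ℱ`-martingale. -/
structure IsInventorySystem (R : Fin n × Fin m → ℝ) (t q : ℝ) [mΩ : MeasurableSpace Ω]
    (μ : Measure Ω) (ℱ : Filtration (Icc t M.T) mΩ)
    (N : Fin n × Fin m → Side → ℝ → Ω → ℕ) : Prop where
  /-- paths are nondecreasing -/
  mono : ∀ j i ω, MonotoneOn (fun s => N j i s ω) (Icc t M.T)
  /-- paths are right-continuous -/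
  right_cont : ∀ j i ω, ∀ s ∈ Ico t M.T, ContinuousWithinAt (fun u => N j i u ω) (Ici s) s
  /-- jumps are of size one -/
  unit_jumps : ∀ j i ω, ∀ s ∈ Ioc t M.T,
    N j i s ω ≤ Function.leftLim (fun u => N j i u ω) s + 1
  /-- almost surely, two different processes never jump at the same time -/
  no_common_jumps : ∀ᵐ ω ∂μ, ∀ s ∈ Ioc t M.T, ∀ j i j' i', (j, i) ≠ (j', i') →
    N j i s ω = Function.leftLim (fun u => N j i u ω) s ∨
      N j' i' s ω = Function.leftLim (fun u => N j' i' u ω) s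
  /-- the processes are adapted -/
  adapted : ∀ j i, ∀ s : Icc t M.T, Measurable[ℱ s] (N j i s)
  /-- `λ^{j,i}` is the intensity of `N j i` -/
  compensated : ∀ j i, Martingale
    (fun (s : Icc t M.T) ω => ((N j i s ω : ℝ) - (N j i t ω : ℝ))
      - ∫ u in t..(s : ℝ), M.intensity R t q N j i u ω) ℱ μ

end MarketModel

end

/-! Along the inventory path, `U(s, 𝒬_s) exp (∫_t^s rate)` has zero drift. The compensated jumps
contribute `∑ λ (U(x + jump) - U(x))`, the term `∑ λ` in the exponent cancels `-∑ λ U(x)`, and what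
remains is the right-hand side of the linear equation. Comparing expectations at `t` and at `T`,
where `U = 1`, gives the formula.

The comparison is the exponential Dynkin formula `IsStateDrivenSystem.dynkin`, obtained from the
martingale property on deterministic partitions, without stochastic integrals. By `increment_eq`,
each increment is the sum of a compensated part, of martingale increments with coefficients known at
the left end point, and of an error that vanishes unless several jumps share a cell. As the mesh
tends to zero, the first part tends to the integral of the drift (`tendsto_sum_compensatedStep`).
The second always has mean zero. The third is eventually zero on almost every path, since almost
surely no two jumps coincide (`IsCountingPath.exists_increment_le_one`).

Dynkin's formula is proved for bounded data, while `x ^ 2` is unbounded. However, a trade that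
pushes the inventory down is possible only above `-qBar`, one that pushes it up only below `qBar`,
and each moves it by less than one. The inventory therefore stays in `[-L, L]` for `L = |q| + qBar +
1`. This is `ae_forall_mem_of_absorbing`, itself Dynkin's formula for the indicator of a complement.
Cutting the data off outside `[-L, L]` then changes nothing almost surely, and boundedness of the
cut-off rate gives integrability.

Positivity of `cHat` is independent of all this and rests on `0 < bCst < aCst`. -/

open Filter Topology

/-! ### Uniform partitions and limits of sums over their cells -/

/-- The `k`-th point of the uniform partition of `[a, b]` into `n + 1` intervals. -/
noncomputable def gridPt (a b : ℝ) (n k : ℕ) : ℝ := a + k * ((b - a) / (n + 1))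

lemma gridPt_zero (a b : ℝ) (n : ℕ) : gridPt a b n 0 = a := by simp [gridPt]

lemma gridPt_last (a b : ℝ) (n : ℕ) : gridPt a b n (n + 1) = b := by
  have : (n : ℝ) + 1 ≠ 0 := by positivity
  simp only [gridPt]; push_cast; field_simp; ring

lemma gridPt_succ (a b : ℝ) (n k : ℕ) :
    gridPt a b n (k + 1) = gridPt a b n k + (b - a) / (n + 1) := by
  simp only [gridPt]; push_cast; ring

lemma gridPt_mono {a b : ℝ} (hab : a ≤ b) (n : ℕ) : Monotone (gridPt a b n) := by
  refine monotone_nat_of_le_succ fun k => ?_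
  rw [gridPt_succ]
  have : 0 ≤ (b - a) / (n + 1) := div_nonneg (by linarith) (by positivity)
  linarith

lemma gridPt_mem {a b : ℝ} (hab : a ≤ b) {n k : ℕ} (hk : k ≤ n + 1) :
    gridPt a b n k ∈ Icc a b := by
  refine ⟨?_, ?_⟩
  · have := gridPt_mono hab n (Nat.zero_le k); rwa [gridPt_zero] at this
  · have := gridPt_mono hab n hk; rwa [gridPt_last] at this

/-- The index of the partition interval, open on the left, that contains `s`. -/
noncomputable def gridIdx (a b : ℝ) (n : ℕ) (s : ℝ) : ℕ := ⌈(s - a) / ((b - a) / (n + 1))⌉₊ - 1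

lemma gridIdx_eq {a b : ℝ} (hab : a < b) {n k : ℕ} {s : ℝ}
    (hs : s ∈ Ioc (gridPt a b n k) (gridPt a b n (k + 1))) : gridIdx a b n s = k := by
  have hh : 0 < (b - a) / (n + 1) := div_pos (by linarith) (by positivity)
  have : ⌈(s - a) / ((b - a) / (n + 1))⌉₊ = k + 1 := by
    rw [Nat.ceil_eq_iff (by omega)]
    simp only [gridPt, mem_Ioc] at hs
    constructor
    · rw [lt_div_iff₀ hh]; simp; linarith
    · rw [div_le_iff₀ hh]; linarith
  rw [gridIdx, this]; rfl

lemma gridIdx_spec {a b : ℝ} (hab : a < b) (n : ℕ) {s : ℝ} (hs : s ∈ Ioc a b) :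
    gridIdx a b n s < n + 1 ∧
      s ∈ Ioc (gridPt a b n (gridIdx a b n s)) (gridPt a b n (gridIdx a b n s + 1)) := by
  have hh : 0 < (b - a) / (n + 1) := div_pos (by linarith) (by positivity)
  have hpos : 0 < (s - a) / ((b - a) / (n + 1)) := div_pos (by linarith [hs.1]) hh
  have hc : 0 < ⌈(s - a) / ((b - a) / (n + 1))⌉₊ := Nat.ceil_pos.2 hpos
  obtain ⟨k, hk⟩ : ∃ k, ⌈(s - a) / ((b - a) / (n + 1))⌉₊ = k + 1 := ⟨_, (Nat.succ_pred_eq_of_pos hc).symm⟩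
  have hidx : gridIdx a b n s = k := by rw [gridIdx, hk]; rfl
  rw [hidx]
  have hk' := (Nat.ceil_eq_iff (by omega)).1 hk
  rw [lt_div_iff₀ hh, div_le_iff₀ hh] at hk'
  have hmem : s ∈ Ioc (gridPt a b n k) (gridPt a b n (k + 1)) := by
    simp only [gridPt, mem_Ioc]
    have := hk'.1; simp at this
    exact ⟨by linarith, by linarith [hk'.2]⟩
  refine ⟨?_, hmem⟩
  by_contra hcon
  have := gridPt_mono hab.le n (not_lt.1 hcon)
  rw [gridPt_last] at this
  linarith [hs.2, hmem.1]

lemma tendsto_gridStep (a b : ℝ) : Tendsto (fun n : ℕ => (b - a) / ((n : ℝ) + 1)) atTop (𝓝 0) := by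
  have := (tendsto_one_div_add_atTop_nhds_zero_nat (𝕜 := ℝ)).const_mul (b - a)
  simpa [div_eq_mul_inv] using this

/-- Sums of integrals over the intervals of finer and finer partitions, with integrands that depend
on the end points of the interval, converge to the integral of the pointwise limit. -/
theorem tendsto_sum_integral_grid {a b K : ℝ} (hab : a < b) {F : ℝ → ℝ → ℝ → ℝ} {f : ℝ → ℝ}
    (hF : ∀ u v, a ≤ u → u ≤ v → v ≤ b → IntervalIntegrable (F u v) volume u v)
    (hK : ∀ u v s, a ≤ u → u ≤ s → s ≤ v → v ≤ b → |F u v s| ≤ K)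
    (hlim : ∀ᵐ s, s ∈ Ioc a b → Tendsto (fun p : ℝ × ℝ => F p.1 p.2 s)
      (𝓝[Ico a s] s ×ˢ 𝓝[Icc s b] s) (𝓝 (f s))) :
    Tendsto (fun n : ℕ => ∑ k ∈ Finset.range (n + 1), ∫ s in gridPt a b n k..gridPt a b n (k + 1),
      F (gridPt a b n k) (gridPt a b n (k + 1)) s) atTop (𝓝 (∫ s in a..b, f s)) := by
  -- These are the end points of the cell containing `s`. With them the sum is a single integral
  -- over `[a, b]`, to which dominated convergence applies.
  set lo : ℕ → ℝ → ℝ := fun n s => gridPt a b n (gridIdx a b n s) with hlo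
  set hi : ℕ → ℝ → ℝ := fun n s => gridPt a b n (gridIdx a b n s + 1) with hhi
  have hcongr : ∀ n k, EqOn (F (gridPt a b n k) (gridPt a b n (k + 1)))
      (fun s => F (lo n s) (hi n s) s) (uIoc (gridPt a b n k) (gridPt a b n (k + 1))) := by
    intro n k s hs
    rw [uIoc_of_le (gridPt_mono hab.le n (Nat.le_succ k))] at hs
    simp only [hlo, hhi, gridIdx_eq hab hs]
  have hint : ∀ n, ∀ k < n + 1, IntervalIntegrable (fun s => F (lo n s) (hi n s) s) volume
      (gridPt a b n k) (gridPt a b n (k + 1)) := by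
    intro n k hk
    refine (intervalIntegrable_congr (hcongr n k)).1 (hF _ _ ?_ ?_ ?_)
    · exact (gridPt_mem hab.le hk.le).1
    · exact gridPt_mono hab.le n (Nat.le_succ k)
    · exact (gridPt_mem hab.le hk).2
  have hsum : ∀ n : ℕ, ∑ k ∈ Finset.range (n + 1), ∫ s in gridPt a b n k..gridPt a b n (k + 1),
      F (gridPt a b n k) (gridPt a b n (k + 1)) s = ∫ s in a..b, F (lo n s) (hi n s) s := by
    intro n
    have h1 := intervalIntegral.sum_integral_adjacent_intervals (hint n)
    rw [gridPt_zero, gridPt_last] at h1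
    rw [← h1]
    refine Finset.sum_congr rfl fun k _ => ?_
    refine intervalIntegral.integral_congr_ae (ae_of_all _ fun s hs => hcongr n k hs)
  simp_rw [hsum]
  refine intervalIntegral.tendsto_integral_filter_of_dominated_convergence (fun _ => K) ?_ ?_ ?_ ?_
  · refine Eventually.of_forall fun n => ?_
    have h1 := IntervalIntegrable.trans_iterate (hint n)
    rw [gridPt_zero, gridPt_last] at h1
    rw [uIoc_of_le hab.le]
    exact h1.1.aestronglyMeasurable
  · refine Eventually.of_forall fun n => ae_of_all _ fun s hs => ?_
    rw [uIoc_of_le hab.le] at hs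
    obtain ⟨h1, h2⟩ := gridIdx_spec hab n hs
    exact hK _ _ _ (gridPt_mem hab.le h1.le).1 h2.1.le h2.2 (gridPt_mem hab.le h1).2
  · exact intervalIntegrable_const
  · filter_upwards [hlim] with s hs hs'
    rw [uIoc_of_le hab.le] at hs'
    have hstep : ∀ n, hi n s = lo n s + (b - a) / (n + 1) := fun n => gridPt_succ _ _ _ _
    have h0 := tendsto_gridStep a b
    have hspec := fun n => gridIdx_spec hab n hs'
    refine (hs hs').comp (Tendsto.prodMk (f := atTop) (m₁ := fun n => lo n s) (m₂ := fun n => hi n s) ?_ ?_)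
    · refine tendsto_nhdsWithin_iff.2 ⟨?_, Eventually.of_forall fun n => ?_⟩
      · refine tendsto_of_tendsto_of_tendsto_of_le_of_le
          (by simpa using (tendsto_const_nhds (x := s)).sub h0) tendsto_const_nhds
          (fun n => ?_) (fun n => (hspec n).2.1.le)
        have := (hspec n).2.2
        change s ≤ hi n s at this
        rw [hstep] at this
        simp only; linarith
      · exact ⟨(gridPt_mem hab.le (hspec n).1.le).1, (hspec n).2.1⟩
    · refine tendsto_nhdsWithin_iff.2 ⟨?_, Eventually.of_forall fun n => ?_⟩
      · refine tendsto_of_tendsto_of_tendsto_of_le_of_le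
          tendsto_const_nhds (by simpa using (tendsto_const_nhds (x := s)).add h0)
          (fun n => (hspec n).2.2) (fun n => ?_)
        have := (hspec n).2.1
        change lo n s < s at this
        simp only [hstep]; linarith
      · exact ⟨(hspec n).2.2, (gridPt_mem hab.le (hspec n).1).2⟩

/-! ### Counting paths -/

/-- A counting path on `[t, T]`: nondecreasing, right-continuous and `ℕ`-valued. -/
structure IsCountingPath (t T : ℝ) (f : ℝ → ℕ) : Prop where
  mono : MonotoneOn f (Icc t T)
  right_cont : ∀ s ∈ Ico t T, ContinuousWithinAt f (Ici s) s

namespace IsCountingPath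

variable {t T : ℝ} {f : ℝ → ℕ}

lemma eventually_right (hf : IsCountingPath t T f) {s : ℝ} (hs : s ∈ Ico t T) :
    ∀ᶠ u in 𝓝[≥] s, f u = f s := by
  have h := hf.right_cont s hs
  rw [ContinuousWithinAt, nhds_discrete] at h
  exact tendsto_pure.1 h

/-- The values on `Ico t s` are naturals bounded by `f s`, so their supremum is attained at some
`u₀`. By monotonicity `f` is constant between `u₀` and `s`. -/
lemma eventually_leftLim (hf : IsCountingPath t T f) {s : ℝ} (hs : s ∈ Ioc t T) :
    ∀ᶠ u in 𝓝[<] s, f u = Function.leftLim f s := by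
  have hex : ∃ y, ∀ᶠ u in 𝓝[<] s, f u = y := by
    have hne : (f '' Ico t s).Nonempty := ⟨f t, t, ⟨le_rfl, hs.1⟩, rfl⟩
    have hbdd : BddAbove (f '' Ico t s) := by
      refine ⟨f s, ?_⟩
      rintro _ ⟨u, hu, rfl⟩
      exact hf.mono ⟨hu.1, hu.2.le.trans hs.2⟩ ⟨hs.1.le, hs.2⟩ hu.2.le
    obtain ⟨u₀, hu₀, hmax⟩ := Nat.sSup_mem hne hbdd
    refine ⟨f u₀, ?_⟩
    filter_upwards [Ioo_mem_nhdsLT hu₀.2] with u hu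
    refine le_antisymm ?_ ?_
    · rw [hmax]
      exact le_csSup hbdd ⟨u, ⟨hu₀.1.trans hu.1.le, hu.2⟩, rfl⟩
    · exact hf.mono ⟨hu₀.1, hu₀.2.le.trans hs.2⟩
        ⟨hu₀.1.trans hu.1.le, hu.2.le.trans hs.2⟩ hu.1.le
  obtain ⟨y, hy⟩ := hex
  have : Function.leftLim f s = y :=
    leftLim_eq_of_tendsto (tendsto_const_nhds.congr' (hy.mono fun _ h => h.symm))
  rw [this]; exact hy

/-- A monotone function has countably many discontinuities, and continuity into a discrete space is
local constancy. -/
lemma ae_eventually_left (hf : IsCountingPath t T f) :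
    ∀ᵐ s, s ∈ Ioc t T → ∀ᶠ u in 𝓝[<] s, f u = f s := by
  have hc := hf.mono.countable_not_continuousWithinAt
  filter_upwards [hc.ae_notMem volume] with s hs hsI
  have hcont : ContinuousWithinAt f (Icc t T) s := by
    by_contra h
    exact hs ⟨⟨hsI.1.le, hsI.2⟩, h⟩
  rw [ContinuousWithinAt, nhds_discrete] at hcont
  have h1 := tendsto_pure.1 hcont
  have h2 : 𝓝[<] s ≤ 𝓝[Icc t T] s := by
    rw [← nhdsWithin_Ioo_eq_nhdsLT hsI.1]
    exact nhdsWithin_mono _ fun u hu => ⟨hu.1.le, hu.2.le.trans hsI.2⟩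
  exact h2 h1

lemma aemeasurable (hf : IsCountingPath t T f) : AEMeasurable f (volume.restrict (Icc t T)) :=
  aemeasurable_restrict_of_monotoneOn measurableSet_Icc hf.mono

end IsCountingPath

namespace IsCountingPath

lemma of_le {t S T : ℝ} {f : ℝ → ℕ} (hf : IsCountingPath t T f) (hS : S ≤ T) :
    IsCountingPath t S f :=
  ⟨hf.mono.mono (Icc_subset_Icc_right hS), fun s hs => hf.right_cont s ⟨hs.1, hs.2.trans_le hS⟩⟩

lemma sum {ι : Type*} [Fintype ι] {t T : ℝ} {v : ι → ℝ → ℕ}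
    (hv : ∀ p, IsCountingPath t T (v p)) : IsCountingPath t T (fun s => ∑ p, v p s) where
  mono := fun _ ha _ hb hab => Finset.sum_le_sum fun p _ => (hv p).mono ha hb hab
  right_cont := fun s hs => by
    have h : ∀ p, ContinuousWithinAt (v p) (Ici s) s := fun p => (hv p).right_cont s hs
    exact tendsto_finsetSum _ fun p _ => h p

/-- A counting path with unit jumps increases by at most one on sufficiently short intervals. -/
lemma exists_increment_le_one {t T : ℝ} {f : ℝ → ℕ} (hf : IsCountingPath t T f)
    (hjump : ∀ s ∈ Ioc t T, f s ≤ Function.leftLim f s + 1) :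
    ∃ δ > 0, ∀ a ∈ Icc t T, ∀ b ∈ Icc t T, a ≤ b → b - a < δ → f b ≤ f a + 1 := by
  -- Near `s` the path equals `f s` on the right and is at least `f s - 1` on the left, so any two
  -- values there differ by at most one.
  have hloc : ∀ s ∈ Icc t T, ∃ ε > 0, ∀ a ∈ Icc t T, ∀ b ∈ Icc t T, a ≤ b →
      a ∈ Metric.ball s ε → b ∈ Metric.ball s ε → f b ≤ f a + 1 := by
    intro s hs
    have hR : ∃ ε > 0, ∀ u ∈ Icc t T, s ≤ u → u < s + ε → f u = f s := by
      rcases hs.2.lt_or_eq with h | h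
      · have := hf.eventually_right ⟨hs.1, h⟩
        obtain ⟨c, hc, hc'⟩ := mem_nhdsGE_iff_exists_Ico_subset.1 this
        refine ⟨c - s, sub_pos.2 hc, fun u _ h1 h2 => hc' ⟨h1, by linarith⟩⟩
      · exact ⟨1, one_pos, fun u hu h1 _ => by rw [le_antisymm (hu.2.trans h.ge) h1]⟩
    have hL : ∃ ε > 0, ∀ u ∈ Icc t T, s - ε < u → f s ≤ f u + 1 := by
      rcases hs.1.lt_or_eq with h | h
      · have := hf.eventually_leftLim ⟨h, hs.2⟩
        obtain ⟨c, hc, hc'⟩ := mem_nhdsLT_iff_exists_Ioo_subset.1 this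
        refine ⟨s - c, sub_pos.2 hc, fun u hu h1 => ?_⟩
        rcases lt_or_ge u s with h2 | h2
        · have h3 : f u = Function.leftLim f s := hc' ⟨by linarith, h2⟩
          rw [h3]; exact hjump s ⟨h, hs.2⟩
        · exact (hf.mono hs hu h2).trans (Nat.le_succ _)
      · exact ⟨1, one_pos, fun u hu _ =>
          (hf.mono hs hu (h ▸ hu.1)).trans (Nat.le_succ _)⟩
    obtain ⟨ε₁, h₁, hR⟩ := hR
    obtain ⟨ε₂, h₂, hL⟩ := hL
    refine ⟨min ε₁ ε₂, lt_min h₁ h₂, fun a ha b hb hab hab1 hab2 => ?_⟩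
    rw [Real.ball_eq_Ioo] at hab1 hab2
    rcases le_total s b with h | h
    · rw [hR b hb h (by linarith [hab2.2, min_le_left ε₁ ε₂])]
      exact hL a ha (by linarith [hab1.1, min_le_right ε₁ ε₂])
    · exact (hf.mono hb hs h).trans (hL a ha (by linarith [hab1.1, min_le_right ε₁ ε₂]))
  choose! ε hε hloc using hloc
  -- A Lebesgue number of this cover of the compact `[t, T]` makes the local bound uniform.
  obtain ⟨δ, hδ, hleb⟩ := lebesgue_number_lemma_of_metric (isCompact_Icc (a := t) (b := T))
    (c := fun s : Icc t T => Metric.ball (s : ℝ) (ε s)) (fun _ => Metric.isOpen_ball)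
    (fun s hs => mem_iUnion.2 ⟨⟨s, hs⟩, Metric.mem_ball_self (hε s hs)⟩)
  refine ⟨δ, hδ, fun a ha b hb hab hlt => ?_⟩
  obtain ⟨s, hs⟩ := hleb a ha
  refine hloc s s.2 a ha b hb hab (hs (Metric.mem_ball_self hδ)) (hs ?_)
  rw [Metric.mem_ball, Real.dist_eq, abs_of_nonneg (by linarith)]
  exact hlt

end IsCountingPath

/-! ### The state driven by counting paths -/

/-- The state at time `s` of the path started from `q` at time `t` which moves by `d p` at each jump
of the counting path `v p`. -/
def pathState {ι : Type*} [Fintype ι] (q : ℝ) (d : ι → ℝ) (v : ι → ℝ → ℕ) (t s : ℝ) : ℝ :=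
  q + ∑ p, d p * ((v p s : ℝ) - v p t)

section PathState

variable {ι : Type*} [Fintype ι] {q : ℝ} {d : ι → ℝ} {v : ι → ℝ → ℕ} {t T : ℝ}

lemma pathState_start : pathState q d v t t = q := by simp [pathState]

lemma pathState_congr {s u : ℝ} (h : ∀ p, v p u = v p s) :
    pathState q d v t u = pathState q d v t s := by
  simp only [pathState, h]

lemma pathState_eventually_right (hv : ∀ p, IsCountingPath t T (v p)) {s : ℝ} (hs : s ∈ Ico t T) :
    ∀ᶠ u in 𝓝[≥] s, pathState q d v t u = pathState q d v t s := by
  filter_upwards [eventually_all.2 fun p => (hv p).eventually_right hs] with u hu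
  exact pathState_congr hu

lemma pathState_ae_eventually_left (hv : ∀ p, IsCountingPath t T (v p)) :
    ∀ᵐ s, s ∈ Ioc t T → ∀ᶠ u in 𝓝[<] s, pathState q d v t u = pathState q d v t s := by
  filter_upwards [ae_all_iff.2 fun p => (hv p).ae_eventually_left] with s hs hsI
  filter_upwards [eventually_all.2 fun p => hs p hsI] with u hu
  exact pathState_congr hu

lemma pathState_ae_leftLim (hv : ∀ p, IsCountingPath t T (v p)) :
    ∀ᵐ s, s ∈ Ioc t T → Function.leftLim (pathState q d v t) s = pathState q d v t s := by
  filter_upwards [pathState_ae_eventually_left (q := q) (d := d) hv] with s hs hsI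
  exact leftLim_eq_of_tendsto (tendsto_const_nhds.congr' ((hs hsI).mono fun _ h => h.symm))

/-- Monotone counts take finitely many values on `[t, T]`, hence so does the state. No regularity of
`g` is involved. -/
lemma pathState_bddAbove (hv : ∀ p, IsCountingPath t T (v p)) (g : ℝ → ℝ) :
    ∃ K, ∀ s ∈ Icc t T, |g (pathState q d v t s)| ≤ K := by
  let ψ : (ι → ℕ) → ℝ := fun c => |g (q + ∑ p, d p * ((c p : ℝ) - v p t))|
  obtain ⟨K, hK⟩ := ((Finite.pi' fun p => finite_Iic (v p T)).image ψ).bddAbove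
  refine ⟨K, fun s hs => hK ⟨fun p => v p s, fun p => ?_, rfl⟩⟩
  exact (hv p).mono hs ⟨hs.1.trans hs.2, le_rfl⟩ hs.2

/-- The state factors through the countable space of count vectors, on which every function is
measurable, so `g` may be arbitrary. -/
lemma pathState_intervalIntegrable (hv : ∀ p, IsCountingPath t T (v p)) (g : ℝ → ℝ) {a b : ℝ}
    (ha : a ∈ Icc t T) (hb : b ∈ Icc t T) :
    IntervalIntegrable (fun s => g (pathState q d v t s)) volume a b := by
  have hsub : uIcc a b ⊆ Icc t T := uIcc_subset_Icc ha hb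
  have hmeas : AEMeasurable (fun s p => v p s) (volume.restrict (Icc t T)) :=
    aemeasurable_pi_iff.2 fun p => (hv p).aemeasurable
  have hmeas' : AEMeasurable (fun s => g (pathState q d v t s)) (volume.restrict (Icc t T)) :=
    (measurable_of_countable
      (fun c : ι → ℕ => g (q + ∑ p, d p * ((c p : ℝ) - v p t)))).comp_aemeasurable hmeas
  obtain ⟨K, hK⟩ := pathState_bddAbove (q := q) (d := d) hv g
  have hint : IntegrableOn (fun s => g (pathState q d v t s)) (Icc t T) := by
    refine Integrable.of_bound (C := K) hmeas'.aestronglyMeasurable ?_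
    filter_upwards [ae_restrict_mem measurableSet_Icc] with s hs
    exact hK s hs
  exact (hint.mono_set hsub).intervalIntegrable

/-- If at most one jump occurs between `a` and `b`, the increment of a function of the state is the
sum of its jumps. -/
lemma sub_eq_sum_of_increment_le_one {a b : ℝ} (hmono : ∀ p, v p a ≤ v p b)
    (h1 : ∑ p, v p b ≤ ∑ p, v p a + 1) (g : ℝ → ℝ) :
    g (pathState q d v t b) - g (pathState q d v t a) =
      ∑ p, (g (pathState q d v t a + d p) - g (pathState q d v t a)) *
        ((v p b : ℝ) - v p a) := by
  classical
  have hsub : pathState q d v t b = pathState q d v t a + ∑ p, d p * ((v p b : ℝ) - v p a) := by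
    simp only [pathState, add_assoc, ← Finset.sum_add_distrib]
    congr 1
    refine Finset.sum_congr rfl fun p _ => by ring
  by_cases hall : ∀ p, v p b = v p a
  · simp [pathState_congr hall, hall]
  · push Not at hall
    obtain ⟨p₀, hp₀⟩ := hall
    have hone : v p₀ a + 1 ≤ v p₀ b := (hmono p₀).lt_of_ne hp₀.symm
    have hrest : ∑ p ∈ Finset.univ.erase p₀, v p a ≤ ∑ p ∈ Finset.univ.erase p₀, v p b :=
      Finset.sum_le_sum fun p _ => hmono p
    rw [← Finset.add_sum_erase _ _ (Finset.mem_univ p₀),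
      ← Finset.add_sum_erase _ (fun p => v p a) (Finset.mem_univ p₀)] at h1
    have hp₀' : v p₀ b = v p₀ a + 1 := by omega
    have hsumeq : ∑ p ∈ Finset.univ.erase p₀, v p a = ∑ p ∈ Finset.univ.erase p₀, v p b := by omega
    have hother : ∀ p, p ≠ p₀ → v p b = v p a := fun p hp =>
      ((Finset.sum_eq_sum_iff_of_le fun p _ => hmono p).1 hsumeq p
        (Finset.mem_erase.2 ⟨hp, Finset.mem_univ p⟩)).symm
    have hsingle : ∀ c : ι → ℝ, ∑ p, c p * ((v p b : ℝ) - v p a) = c p₀ := by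
      intro c
      rw [Finset.sum_eq_single p₀ (fun p _ hp => by rw [hother p hp]; simp) (by simp), hp₀']
      push_cast; ring
    rw [hsub, hsingle, hsingle]

end PathState

/-! ### The exponential weight along a path -/

/-- The exponential weight `exp (∫_t^s r(X_u) du)` along the path `X`. -/
noncomputable def expWeight (r : ℝ → ℝ) (X : ℝ → ℝ) (t s : ℝ) : ℝ :=
  Real.exp (∫ u in t..s, r (X u))

section ExpWeight

variable {ι : Type*} [Fintype ι] {q : ℝ} {d : ι → ℝ} {v : ι → ℝ → ℕ} {t T : ℝ}

lemma expWeight_pos (r X : ℝ → ℝ) (t s : ℝ) : 0 < expWeight r X t s := Real.exp_pos _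

lemma expWeight_start (r X : ℝ → ℝ) (t : ℝ) : expWeight r X t t = 1 := by simp [expWeight]

lemma expWeight_le {r X : ℝ → ℝ} {K : ℝ} (hr : ∀ x, |r x| ≤ K) {s : ℝ} (hs : s ∈ Icc t T) :
    expWeight r X t s ≤ Real.exp (K * (T - t)) := by
  have hK : 0 ≤ K := (abs_nonneg _).trans (hr 0)
  refine Real.exp_le_exp.2 ((le_abs_self _).trans ?_)
  have h := intervalIntegral.norm_integral_le_of_norm_le_const (a := t) (b := s)
    (f := fun u => r (X u)) (C := K) fun u _ => hr _
  rw [Real.norm_eq_abs, abs_of_nonneg (sub_nonneg.2 hs.1)] at h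
  exact h.trans (mul_le_mul_of_nonneg_left (by linarith [hs.2]) hK)

lemma continuousOn_expWeight (hv : ∀ p, IsCountingPath t T (v p)) (r : ℝ → ℝ) :
    ContinuousOn (expWeight r (pathState q d v t) t) (Icc t T) := by
  rcases lt_or_ge T t with h | h
  · simp [Icc_eq_empty_of_lt h]
  have := intervalIntegral.continuousOn_primitive_interval' (a := t) (b₁ := t) (b₂ := T)
    (pathState_intervalIntegrable (q := q) (d := d) hv r ⟨le_rfl, h⟩ ⟨h, le_rfl⟩) left_mem_uIcc
  rw [uIcc_of_le h] at this
  exact this.rexp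

/-- The state is constant just to the right of `s`. At a jump time only the right derivative has
this value, which is enough for the fundamental theorem of calculus in `mul_expWeight_sub`. -/
lemma hasDerivWithinAt_expWeight (hv : ∀ p, IsCountingPath t T (v p)) (r : ℝ → ℝ) {s : ℝ}
    (hs : s ∈ Ico t T) :
    HasDerivWithinAt (expWeight r (pathState q d v t) t)
      (expWeight r (pathState q d v t) t s * r (pathState q d v t s)) (Ioi s) s := by
  have hev := pathState_eventually_right (q := q) (d := d) hv hs
  have hint := pathState_intervalIntegrable (q := q) (d := d) hv r
    ⟨le_rfl, hs.1.trans hs.2.le⟩ ⟨hs.1, hs.2.le⟩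
  refine HasDerivWithinAt.exp (f := fun s => ∫ u in t..s, r (pathState q d v t u)) ?_
  have hcont : ContinuousWithinAt (fun u => r (pathState q d v t u)) (Ici s) s :=
    tendsto_const_nhds.congr' (hev.mono fun u hu => congrArg r hu.symm)
  refine (intervalIntegral.integral_hasDerivWithinAt_right (s := Ici s) (t := Ioi s) hint ?_
    (hcont.mono Ioi_subset_Ici_self)).mono Ioi_subset_Ici_self
  have hint' := pathState_intervalIntegrable (q := q) (d := d) hv r
    ⟨hs.1, hs.2.le⟩ ⟨hs.1.trans hs.2.le, le_rfl⟩
  exact ⟨Ioc s T, Ioc_mem_nhdsGT hs.2, hint'.1.aestronglyMeasurable⟩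

/-- The fundamental theorem of calculus for the product of a `C¹` function and the weight. -/
lemma mul_expWeight_sub (hv : ∀ p, IsCountingPath t T (v p)) (r : ℝ → ℝ) {g g' : ℝ → ℝ}
    (hg : ∀ s ∈ Icc t T, HasDerivWithinAt g (g' s) (Icc t T) s) (hg' : ContinuousOn g' (Icc t T))
    {a b : ℝ} (ha : t ≤ a) (hab : a ≤ b) (hb : b ≤ T) :
    IntervalIntegrable (fun s => expWeight r (pathState q d v t) t s *
        (g' s + r (pathState q d v t s) * g s)) volume a b ∧
      g b * expWeight r (pathState q d v t) t b - g a * expWeight r (pathState q d v t) t a =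
      ∫ s in a..b, expWeight r (pathState q d v t) t s *
        (g' s + r (pathState q d v t s) * g s) := by
  set w := expWeight r (pathState q d v t) t with hw
  have hsub : Icc a b ⊆ Icc t T := Icc_subset_Icc ha hb
  have hgc : ContinuousOn g (Icc t T) := fun s hs => (hg s hs).continuousWithinAt
  have hwc : ContinuousOn w (Icc t T) := continuousOn_expWeight hv r
  have hint : IntervalIntegrable (fun s => w s * (g' s + r (pathState q d v t s) * g s))
      volume a b := by
    refine IntervalIntegrable.continuousOn_mul ?_ (by rw [uIcc_of_le hab]; exact hwc.mono hsub)
    refine IntervalIntegrable.add (ContinuousOn.intervalIntegrable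
      (by rw [uIcc_of_le hab]; exact hg'.mono hsub)) ?_
    exact (pathState_intervalIntegrable hv r (hsub ⟨le_rfl, hab⟩) (hsub ⟨hab, le_rfl⟩)).mul_continuousOn
      (by rw [uIcc_of_le hab]; exact hgc.mono hsub)
  refine ⟨hint, ?_⟩
  refine (intervalIntegral.integral_eq_sub_of_hasDeriv_right_of_le hab
    ((hgc.mul hwc).mono hsub) (fun s hs => ?_) hint).symm
  have hsI : s ∈ Ico t T := ⟨ha.trans hs.1.le, hs.2.trans_le hb⟩
  have h1 : HasDerivWithinAt g (g' s) (Ioi s) s :=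
    ((hg s ⟨hsI.1, hsI.2.le⟩).hasDerivAt
      (Icc_mem_nhds (ha.trans_lt hs.1) (hs.2.trans_le hb))).hasDerivWithinAt
  have h2 := h1.mul (hasDerivWithinAt_expWeight (q := q) (d := d) hv r hsI)
  refine h2.congr_deriv ?_
  simp only [hw]; ring

end ExpWeight

/-! ### Splitting an increment: compensated part, jump error, martingale part -/

/-- The drift at time `s` of `G(s, X_s) exp (∫_t^s r(X_u) du)` along a jump process `X` with jumps
`d p` at intensities `lam p X`, where `G'` is the time derivative of `G`. -/
noncomputable def generatorDrift {ι : Type*} [Fintype ι] (d : ι → ℝ) (lam : ι → ℝ → ℝ) (r : ℝ → ℝ)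
    (G G' : ℝ → ℝ → ℝ) (s x : ℝ) : ℝ :=
  G' s x + r x * G s x + ∑ p, lam p x * (G s (x + d p) - G s x)

/-- Bounds on the data of the exponential Dynkin formula on `[t, T]`. -/
structure DynkinData {ι : Type*} [Fintype ι] (t T K : ℝ) (lam : ι → ℝ → ℝ) (r : ℝ → ℝ)
    (G G' : ℝ → ℝ → ℝ) : Prop where
  lam_le : ∀ p x, |lam p x| ≤ K
  r_le : ∀ x, |r x| ≤ K
  le : ∀ s ∈ Icc t T, ∀ x, |G s x| ≤ K
  deriv_le : ∀ s ∈ Icc t T, ∀ x, |G' s x| ≤ K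
  hasDeriv : ∀ x, ∀ s ∈ Icc t T, HasDerivWithinAt (fun s => G s x) (G' s x) (Icc t T) s
  deriv_cont : ∀ x, ContinuousOn (fun s => G' s x) (Icc t T)

/-- The part of the increment of `G(s, X_s) exp (∫_t^s r(X_u) du)` over `[a, b]` which comes from the
passage of time and from the compensators of the jumps. -/
noncomputable def compensatedStep {ι : Type*} [Fintype ι] (d : ι → ℝ) (lam : ι → ℝ → ℝ) (r : ℝ → ℝ)
    (G : ℝ → ℝ → ℝ) (t : ℝ) (X : ℝ → ℝ) (a b : ℝ) : ℝ :=
  (G b (X b) * expWeight r X t b - G a (X b) * expWeight r X t a) +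
    ∑ p, expWeight r X t a * (G a (X a + d p) - G a (X a)) * ∫ s in a..b, lam p (X s)

section

variable {ι : Type*} [Fintype ι] {q : ℝ} {d : ι → ℝ} {v : ι → ℝ → ℕ} {t T K : ℝ}
  {lam : ι → ℝ → ℝ} {r : ℝ → ℝ} {G G' : ℝ → ℝ → ℝ}

lemma DynkinData.nonneg (h : DynkinData t T K lam r G G') : 0 ≤ K :=
  (abs_nonneg _).trans (h.r_le 0)

lemma DynkinData.of_le (h : DynkinData t T K lam r G G') {S : ℝ} (hS : S ≤ T) :
    DynkinData t S K lam r G G' where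
  lam_le := h.lam_le
  r_le := h.r_le
  le := fun s hs => h.le s ⟨hs.1, hs.2.trans hS⟩
  deriv_le := fun s hs => h.deriv_le s ⟨hs.1, hs.2.trans hS⟩
  hasDeriv := fun x s hs =>
    (h.hasDeriv x s ⟨hs.1, hs.2.trans hS⟩).mono (Icc_subset_Icc_right hS)
  deriv_cont := fun x => (h.deriv_cont x).mono (Icc_subset_Icc_right hS)

/-- The integrand over `[a, b]` whose integral is `compensatedStep`. -/
noncomputable def stepIntegrand (d : ι → ℝ) (lam : ι → ℝ → ℝ) (r : ℝ → ℝ)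
    (G G' : ℝ → ℝ → ℝ) (t : ℝ) (X : ℝ → ℝ) (a b s : ℝ) : ℝ :=
  expWeight r X t s * (G' s (X b) + r (X s) * G s (X b)) +
    ∑ p, expWeight r X t a * (G a (X a + d p) - G a (X a)) * lam p (X s)

/-- The first part of the step varies only time, with the state frozen at its final value `X b`, so
the fundamental theorem of calculus applies. The compensators are integrals already. -/
lemma compensatedStep_eq_integral (h : DynkinData t T K lam r G G')
    (hv : ∀ p, IsCountingPath t T (v p)) {a b : ℝ} (ha : t ≤ a) (hab : a ≤ b) (hb : b ≤ T) :
    IntervalIntegrable (stepIntegrand d lam r G G' t (pathState q d v t) a b) volume a b ∧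
      compensatedStep d lam r G t (pathState q d v t) a b =
        ∫ s in a..b, stepIntegrand d lam r G G' t (pathState q d v t) a b s := by
  obtain ⟨h1, h2⟩ := mul_expWeight_sub (q := q) (d := d) hv r
    (h.hasDeriv (pathState q d v t b)) (h.deriv_cont _) ha hab hb
  have h3 : ∀ p ∈ Finset.univ, IntervalIntegrable (fun s => expWeight r (pathState q d v t) t a *
      (G a (pathState q d v t a + d p) - G a (pathState q d v t a)) *
        lam p (pathState q d v t s)) volume a b := fun p _ =>
    (pathState_intervalIntegrable hv (lam p) ⟨ha, hab.trans hb⟩ ⟨ha.trans hab, hb⟩).const_mul _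
  have h4 := IntervalIntegrable.sum Finset.univ h3
  have hfun : stepIntegrand d lam r G G' t (pathState q d v t) a b = fun s =>
      expWeight r (pathState q d v t) t s * (G' s (pathState q d v t b) +
        r (pathState q d v t s) * G s (pathState q d v t b)) +
      (∑ p, fun s => expWeight r (pathState q d v t) t a *
        (G a (pathState q d v t a + d p) - G a (pathState q d v t a)) *
        lam p (pathState q d v t s)) s := by
    funext s; simp only [stepIntegrand, Finset.sum_apply]
  constructor
  · rw [hfun]; exact h1.add h4
  · rw [hfun, intervalIntegral.integral_add h1 h4, ← h2, compensatedStep]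
    congr 1
    simp only [Finset.sum_apply]
    rw [intervalIntegral.integral_finsetSum h3]
    simp only [intervalIntegral.integral_const_mul]

lemma stepIntegrand_le (h : DynkinData t T K lam r G G') (X : ℝ → ℝ)
    {a b s : ℝ} (ha : t ≤ a) (has : a ≤ s) (hsb : s ≤ b) (hb : b ≤ T) :
    |stepIntegrand d lam r G G' t X a b s| ≤ Real.exp (K * (T - t)) * (K + K * K) +
      Fintype.card ι * (Real.exp (K * (T - t)) * (K + K) * K) := by
  have hsI : s ∈ Icc t T := ⟨ha.trans has, hsb.trans hb⟩
  have haI : a ∈ Icc t T := ⟨ha, has.trans hsI.2⟩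
  have hK := h.nonneg
  have hE := (Real.exp_pos (K * (T - t))).le
  have hw : ∀ u ∈ Icc t T, |expWeight r X t u| ≤ Real.exp (K * (T - t)) := fun u hu => by
    rw [abs_of_pos (expWeight_pos _ _ _ _)]; exact expWeight_le h.r_le hu
  refine (abs_add_le _ _).trans (add_le_add ?_ ?_)
  · rw [abs_mul]
    refine mul_le_mul (hw s hsI) ((abs_add_le _ _).trans (add_le_add (h.deriv_le s hsI _) ?_))
      (abs_nonneg _) hE
    rw [abs_mul]
    exact mul_le_mul (h.r_le _) (h.le s hsI _) (abs_nonneg _) hK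
  · refine (Finset.abs_sum_le_sum_abs _ _).trans ((Finset.sum_le_card_nsmul _ _ _ fun p _ => ?_).trans
      (by rw [nsmul_eq_mul, Finset.card_univ]))
    rw [abs_mul, abs_mul]
    refine mul_le_mul (mul_le_mul (hw a haI) ?_ (abs_nonneg _) hE) (h.lam_le p _) (abs_nonneg _)
      (by positivity)
    exact (abs_sub _ _).trans (add_le_add (h.le a haI _) (h.le a haI _))

/-- Almost every `s` is not a jump time, so for close end points `X a = X s = X b`. The remaining
dependence on `a`, through the weight and `G`, is continuous. -/
lemma tendsto_stepIntegrand (h : DynkinData t T K lam r G G')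
    (hv : ∀ p, IsCountingPath t T (v p)) :
    ∀ᵐ s, s ∈ Ioc t T → Tendsto
      (fun p : ℝ × ℝ => stepIntegrand d lam r G G' t (pathState q d v t) p.1 p.2 s)
      (𝓝[Ico t s] s ×ˢ 𝓝[Icc s T] s)
      (𝓝 (expWeight r (pathState q d v t) t s *
        generatorDrift d lam r G G' s (pathState q d v t s))) := by
  filter_upwards [pathState_ae_eventually_left (q := q) (d := d) hv] with s hs hsI
  set X := pathState q d v t with hX
  have hsI' : s ∈ Icc t T := ⟨hsI.1.le, hsI.2⟩
  have hlo : ∀ᶠ a in 𝓝[Ico t s] s, X a = X s :=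
    nhdsWithin_mono _ (fun a ha => ha.2) (hs hsI)
  have hhi : ∀ᶠ b in 𝓝[Icc s T] s, X b = X s := by
    rcases hsI.2.lt_or_eq with hlt | heq
    · exact nhdsWithin_mono _ (fun b hb => hb.1) (pathState_eventually_right hv ⟨hsI.1.le, hlt⟩)
    · filter_upwards [self_mem_nhdsWithin] with b hb
      rw [le_antisymm (hb.2.trans heq.ge) hb.1]
  have hsub : 𝓝[Ico t s] s ≤ 𝓝[Icc t T] s :=
    nhdsWithin_mono _ fun a ha => ⟨ha.1, ha.2.le.trans hsI.2⟩
  have hwt : Tendsto (expWeight r X t) (𝓝[Ico t s] s) (𝓝 (expWeight r X t s)) :=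
    (continuousOn_expWeight hv r s hsI').mono_left hsub
  have hG : ∀ x, Tendsto (fun a => G a x) (𝓝[Ico t s] s) (𝓝 (G s x)) := fun x =>
    (h.hasDeriv x s hsI').continuousWithinAt.mono_left hsub
  have hmain : Tendsto (fun p : ℝ × ℝ => expWeight r X t s * (G' s (X s) + r (X s) * G s (X s)) +
      ∑ j, expWeight r X t p.1 * (G p.1 (X s + d j) - G p.1 (X s)) * lam j (X s))
      (𝓝[Ico t s] s ×ˢ 𝓝[Icc s T] s)
      (𝓝 (expWeight r X t s * (G' s (X s) + r (X s) * G s (X s)) +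
      ∑ j, expWeight r X t s * (G s (X s + d j) - G s (X s)) * lam j (X s))) := by
    refine tendsto_const_nhds.add (tendsto_finsetSum _ fun j _ => ?_)
    exact (((hwt.mul ((hG _).sub (hG _))).mul_const _).comp tendsto_fst)
  have hval : expWeight r X t s * generatorDrift d lam r G G' s (X s) =
      expWeight r X t s * (G' s (X s) + r (X s) * G s (X s)) +
      ∑ j, expWeight r X t s * (G s (X s + d j) - G s (X s)) * lam j (X s) := by
    rw [generatorDrift, mul_add, Finset.mul_sum]
    congr 1
    exact Finset.sum_congr rfl fun j _ => by ring
  rw [hval]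
  refine hmain.congr' ?_
  filter_upwards [tendsto_fst.eventually hlo, tendsto_snd.eventually hhi] with p h1 h2
  simp only [stepIntegrand, h1, h2]

/-- Along finer and finer partitions, the sum of the compensated steps converges to the integral of
the drift. -/
lemma tendsto_sum_compensatedStep (h : DynkinData t T K lam r G G')
    (hv : ∀ p, IsCountingPath t T (v p)) (htT : t < T) :
    Tendsto (fun n : ℕ => ∑ k ∈ Finset.range (n + 1),
      compensatedStep d lam r G t (pathState q d v t) (gridPt t T n k) (gridPt t T n (k + 1))) atTop
      (𝓝 (∫ s in t..T, expWeight r (pathState q d v t) t s *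
        generatorDrift d lam r G G' s (pathState q d v t s))) := by
  refine (tendsto_sum_integral_grid htT
    (F := stepIntegrand d lam r G G' t (pathState q d v t))
    (fun a b ha hab hb => (compensatedStep_eq_integral h hv ha hab hb).1)
    (fun a b s ha has hsb hb => stepIntegrand_le h _ ha has hsb hb)
    (tendsto_stepIntegrand h hv)).congr fun n => ?_
  refine Finset.sum_congr rfl fun k hk => ?_
  rw [Finset.mem_range] at hk
  exact ((compensatedStep_eq_integral h hv (gridPt_mem htT.le hk.le).1
    (gridPt_mono htT.le n (Nat.le_succ k)) (gridPt_mem htT.le hk).2).2).symm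

lemma abs_compensatedStep_le (h : DynkinData t T K lam r G G')
    (hv : ∀ p, IsCountingPath t T (v p)) {a b : ℝ} (ha : t ≤ a) (hab : a ≤ b) (hb : b ≤ T) :
    |compensatedStep d lam r G t (pathState q d v t) a b| ≤
      (Real.exp (K * (T - t)) * (K + K * K) +
        Fintype.card ι * (Real.exp (K * (T - t)) * (K + K) * K)) * (b - a) := by
  rw [(compensatedStep_eq_integral h hv ha hab hb).2]
  have := intervalIntegral.norm_integral_le_of_norm_le_const (a := a) (b := b)
    (f := stepIntegrand d lam r G G' t (pathState q d v t) a b) fun s hs => by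
      rw [uIoc_of_le hab] at hs
      exact stepIntegrand_le h _ ha hs.1.le hs.2 hb
  rwa [Real.norm_eq_abs, abs_of_nonneg (sub_nonneg.2 hab)] at this

/-- The error made over `[a, b]` when the jumps of `G(a, X)` are added up one by one. -/
noncomputable def jumpError (d : ι → ℝ) (v : ι → ℝ → ℕ) (r : ℝ → ℝ)
    (G : ℝ → ℝ → ℝ) (t : ℝ) (X : ℝ → ℝ) (a b : ℝ) : ℝ :=
  expWeight r X t a * ((G a (X b) - G a (X a)) -
    ∑ p, (G a (X a + d p) - G a (X a)) * ((v p b : ℝ) - v p a))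

lemma jumpError_eq_zero {a b : ℝ} (hmono : ∀ p, v p a ≤ v p b)
    (h1 : ∑ p, v p b ≤ ∑ p, v p a + 1) :
    jumpError d v r G t (pathState q d v t) a b = 0 := by
  rw [jumpError, sub_eq_sum_of_increment_le_one hmono h1 (G a), sub_self, mul_zero]

/-- A nonzero error requires at least two jumps, so the bounded increment of `G` is itself at most a
constant times the number of jumps. These bounds telescope over a partition to an integrable
majorant that does not depend on the mesh. -/
lemma abs_jumpError_le (h : DynkinData t T K lam r G G') {a b : ℝ} (ha : a ∈ Icc t T)
    (hmono : ∀ p, v p a ≤ v p b) :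
    |jumpError d v r G t (pathState q d v t) a b| ≤
      Real.exp (K * (T - t)) * ((K + K) * 2) * ∑ p, ((v p b : ℝ) - v p a) := by
  have hK := h.nonneg
  have hE := (Real.exp_pos (K * (T - t))).le
  have hnn : ∀ p, 0 ≤ (v p b : ℝ) - v p a := fun p => sub_nonneg.2 (by exact_mod_cast hmono p)
  by_cases h1 : ∑ p, v p b ≤ ∑ p, v p a + 1
  · rw [jumpError_eq_zero hmono h1, abs_zero]
    exact mul_nonneg (by positivity) (Finset.sum_nonneg fun p _ => hnn p)
  have hge : (1 : ℝ) ≤ ∑ p, ((v p b : ℝ) - v p a) := by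
    rw [Finset.sum_sub_distrib, le_sub_iff_add_le']
    exact_mod_cast (not_le.1 h1).le
  have hdiff : ∀ x y, |G a x - G a y| ≤ K + K := fun x y =>
    (abs_sub _ _).trans (add_le_add (h.le a ha _) (h.le a ha _))
  rw [jumpError, abs_mul, abs_of_pos (expWeight_pos _ _ _ _), mul_assoc]
  refine mul_le_mul (expWeight_le h.r_le ha) ?_ (abs_nonneg _) hE
  refine (abs_sub _ _).trans ?_
  have h2 : |∑ p, (G a (pathState q d v t a + d p) - G a (pathState q d v t a)) *
      ((v p b : ℝ) - v p a)| ≤ (K + K) * ∑ p, ((v p b : ℝ) - v p a) := by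
    refine (Finset.abs_sum_le_sum_abs _ _).trans ?_
    rw [Finset.mul_sum]
    refine Finset.sum_le_sum fun p _ => ?_
    rw [abs_mul, abs_of_nonneg (hnn p)]
    exact mul_le_mul_of_nonneg_right (hdiff _ _) (hnn p)
  have h3 := hdiff (pathState q d v t b) (pathState q d v t a)
  nlinarith

lemma eventually_sum_jumpError_eq_zero (hv : ∀ p, IsCountingPath t T (v p)) (htT : t < T)
    (hjump : ∀ s ∈ Ioc t T, ∑ p, v p s ≤ Function.leftLim (fun u => ∑ p, v p u) s + 1) :
    ∀ᶠ n : ℕ in atTop, ∑ k ∈ Finset.range (n + 1),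
      jumpError d v r G t (pathState q d v t) (gridPt t T n k) (gridPt t T n (k + 1)) = 0 := by
  obtain ⟨δ, hδ, hinc⟩ := (IsCountingPath.sum hv).exists_increment_le_one hjump
  filter_upwards [(tendsto_gridStep t T).eventually (gt_mem_nhds hδ)] with n hn
  refine Finset.sum_eq_zero fun k hk => ?_
  rw [Finset.mem_range] at hk
  have hle : gridPt t T n k ≤ gridPt t T n (k + 1) := gridPt_mono htT.le n (Nat.le_succ k)
  have ha := gridPt_mem htT.le hk.le
  have hb : gridPt t T n (k + 1) ∈ Icc t T := gridPt_mem htT.le hk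
  refine jumpError_eq_zero (fun p => (hv p).mono ha hb hle) (hinc _ ha _ hb hle ?_)
  rw [gridPt_succ]; linarith

/-- The increment of `G(s, X_s) exp (∫_t^s r(X_u) du)`, split into its compensated part, a martingale
increment and the error from several jumps in one step. -/
lemma increment_eq (r : ℝ → ℝ) (G : ℝ → ℝ → ℝ) (lam : ι → ℝ → ℝ) (X : ℝ → ℝ) (a b : ℝ) :
    G b (X b) * expWeight r X t b - G a (X a) * expWeight r X t a =
      compensatedStep d lam r G t X a b + jumpError d v r G t X a b +
      ∑ p, expWeight r X t a * (G a (X a + d p) - G a (X a)) *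
        (((v p b : ℝ) - v p a) - ∫ s in a..b, lam p (X s)) := by
  have h1 : ∑ p, expWeight r X t a * (G a (X a + d p) - G a (X a)) *
      (((v p b : ℝ) - v p a) - ∫ s in a..b, lam p (X s)) =
      expWeight r X t a * ∑ p, (G a (X a + d p) - G a (X a)) * ((v p b : ℝ) - v p a) -
      ∑ p, expWeight r X t a * (G a (X a + d p) - G a (X a)) * ∫ s in a..b, lam p (X s) := by
    rw [Finset.mul_sum, ← Finset.sum_sub_distrib]
    exact Finset.sum_congr rfl fun p _ => by ring
  rw [h1, compensatedStep, jumpError]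
  ring

end

/-! ### The exponential Dynkin formula -/

/-- Finitely many adapted counting processes `N p` on `[t, T]` with jumps of size one, almost surely
without common jumps, whose intensities are functions `lam p` of the state which moves by `d p` at
each jump of `N p`. -/
structure IsStateDrivenSystem {Ω ι : Type*} [Fintype ι] {t T : ℝ} (q : ℝ) (d : ι → ℝ)
    (lam : ι → ℝ → ℝ) [mΩ : MeasurableSpace Ω] (μ : Measure Ω) (ℱ : Filtration (Icc t T) mΩ)
    (N : ι → ℝ → Ω → ℕ) : Prop where
  path : ∀ p ω, IsCountingPath t T (fun s => N p s ω)
  jump : ∀ᵐ ω ∂μ, ∀ s ∈ Ioc t T,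
    ∑ p, N p s ω ≤ Function.leftLim (fun u => ∑ p, N p u ω) s + 1
  adapted : ∀ p, ∀ s : Icc t T, Measurable[ℱ s] (N p s)
  compensated : ∀ p, Martingale (fun (s : Icc t T) ω => ((N p s ω : ℝ) - N p t ω) -
    ∫ u in t..(s : ℝ), lam p (pathState q d (fun p s => N p s ω) t u)) ℱ μ

lemma measurable_comp_pathState {Ω ι : Type*} [Fintype ι] [MeasurableSpace Ω] {N : ι → ℝ → Ω → ℕ}
    {t q : ℝ} {d : ι → ℝ} (g : ℝ → ℝ) {s : ℝ} (ht : ∀ p, Measurable (N p t))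
    (hs : ∀ p, Measurable (N p s)) :
    Measurable (fun ω => g (pathState q d (fun p s => N p s ω) t s)) := by
  have h1 : Measurable (fun ω p => (N p s ω, N p t ω)) :=
    measurable_pi_lambda _ fun p => (hs p).prodMk (ht p)
  let φ : (ι → ℕ × ℕ) → ℝ := fun c => g (q + ∑ p, d p * (((c p).1 : ℝ) - (c p).2))
  have h2 : Measurable φ := measurable_of_countable _
  have h3 := h2.comp h1
  simpa only [φ, Function.comp_def, pathState] using h3

namespace IsStateDrivenSystem

variable {Ω ι : Type*} [Fintype ι] {t T : ℝ} {q : ℝ} {d : ι → ℝ} {lam : ι → ℝ → ℝ}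
  {mΩ : MeasurableSpace Ω} {μ : Measure Ω} {ℱ : Filtration (Icc t T) mΩ}
  {N : ι → ℝ → Ω → ℕ} {K : ℝ} {r : ℝ → ℝ} {G G' : ℝ → ℝ → ℝ}

lemma measurable_comp_state (hN : IsStateDrivenSystem q d lam μ ℱ N) (g : ℝ → ℝ)
    {s : ℝ} (a : Icc t T) (hs : t ≤ s) (hsa : s ≤ a) :
    Measurable[ℱ a] (fun ω => g (pathState q d (fun p s => N p s ω) t s)) := by
  have ht : t ∈ Icc t T := ⟨le_rfl, a.2.1.trans a.2.2⟩
  have hs' : s ∈ Icc t T := ⟨hs, hsa.trans a.2.2⟩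
  have h1 : ∀ p, Measurable[ℱ a] (N p t) := fun p =>
    (hN.adapted p ⟨t, ht⟩).mono (ℱ.mono a.2.1) le_rfl
  have h2 : ∀ p, Measurable[ℱ a] (N p s) := fun p =>
    (hN.adapted p ⟨s, hs'⟩).mono (ℱ.mono hsa) le_rfl
  exact @measurable_comp_pathState Ω ι _ (ℱ a) N t q d g s h1 h2

/-- The integral is a pointwise limit of left-point Riemann sums, which only involve states at grid
times up to `a`. They converge for arbitrary `g` because the state is locally constant to the left
of almost every time. -/
lemma measurable_integral_comp_state (hN : IsStateDrivenSystem q d lam μ ℱ N) (g : ℝ → ℝ)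
    (a : Icc t T) :
    Measurable[ℱ a]
      (fun ω => ∫ u in t..(a : ℝ), g (pathState q d (fun p s => N p s ω) t u)) := by
  rcases a.2.1.eq_or_lt with h | h
  · simp only [← h, intervalIntegral.integral_same]; exact measurable_const
  have hpath : ∀ ω p, IsCountingPath t (a : ℝ) (fun s => N p s ω) := fun ω p =>
    (hN.path p ω).of_le a.2.2
  refine @measurable_of_tendsto_metrizable _ _ (ℱ a) _ _ _ _
    (fun (n : ℕ) ω => ∑ k ∈ Finset.range (n + 1), ∫ _ in gridPt t a n k..gridPt t a n (k + 1),
      g (pathState q d (fun p s => N p s ω) t (gridPt t a n k))) _ (fun n => ?_) ?_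
  · simp only [intervalIntegral.integral_const, smul_eq_mul]
    refine Finset.measurable_fun_sum _ fun k hk => ?_
    rw [Finset.mem_range] at hk
    have := gridPt_mem h.le hk.le
    exact (hN.measurable_comp_state g a this.1 this.2).const_mul _
  · refine tendsto_pi_nhds.2 fun ω => ?_
    obtain ⟨K, hK⟩ := pathState_bddAbove (q := q) (d := d) (hpath ω) g
    refine tendsto_sum_integral_grid (K := K) h
      (F := fun u _ _ => g (pathState q d (fun p s => N p s ω) t u))
      (fun _ _ _ _ _ => intervalIntegrable_const)
      (fun u v s h1 h2 h3 h4 => hK u ⟨h1, (h2.trans h3).trans h4⟩) ?_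
    filter_upwards [pathState_ae_eventually_left (q := q) (d := d) (hpath ω)] with s hs hsI
    have hlo : ∀ᶠ u in 𝓝[Ico t s] s, pathState q d (fun p s => N p s ω) t u =
        pathState q d (fun p s => N p s ω) t s := nhdsWithin_mono _ (fun u hu => hu.2) (hs hsI)
    exact tendsto_const_nhds.congr' ((tendsto_fst.eventually hlo).mono fun _ h => congrArg g h.symm)

lemma measurable_expWeight (hN : IsStateDrivenSystem q d lam μ ℱ N) (r : ℝ → ℝ) {s : ℝ}
    (a : Icc t T) (hs : t ≤ s) (hsa : s ≤ a) :
    Measurable[ℱ a] (fun ω => expWeight r (pathState q d (fun p s => N p s ω) t) t s) :=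
  Real.measurable_exp.comp ((hN.measurable_integral_comp_state r ⟨s, hs, hsa.trans a.2.2⟩).mono
    (ℱ.mono hsa) le_rfl)

lemma measurable_count (hN : IsStateDrivenSystem q d lam μ ℱ N) (p : ι) {s : ℝ}
    (hs : s ∈ Icc t T) : Measurable (fun ω => (N p s ω : ℝ)) :=
  measurable_from_top.comp ((hN.adapted p ⟨s, hs⟩).mono (ℱ.le _) le_rfl)

lemma compensated_increment (hN : IsStateDrivenSystem q d lam μ ℱ N) (p : ι) (ω : Ω) {a b : ℝ}
    (ha : a ∈ Icc t T) (hb : b ∈ Icc t T) :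
    ((N p b ω : ℝ) - N p a ω) - ∫ u in a..b, lam p (pathState q d (fun p s => N p s ω) t u) =
    (((N p b ω : ℝ) - N p t ω) - ∫ u in t..b, lam p (pathState q d (fun p s => N p s ω) t u)) -
    (((N p a ω : ℝ) - N p t ω) -
      ∫ u in t..a, lam p (pathState q d (fun p s => N p s ω) t u)) := by
  have ht : t ∈ Icc t T := ⟨le_rfl, ha.1.trans ha.2⟩
  have hi : ∀ {c e}, c ∈ Icc t T → e ∈ Icc t T → IntervalIntegrable
      (fun u => lam p (pathState q d (fun p s => N p s ω) t u)) volume c e := fun hc he =>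
    pathState_intervalIntegrable (fun p => hN.path p ω) (lam p) hc he
  rw [← intervalIntegral.integral_add_adjacent_intervals (hi ht ha) (hi ha hb)]
  ring

/-- The count is an integrable martingale plus a bounded compensator. -/
lemma integrable_increment [IsProbabilityMeasure μ] (hN : IsStateDrivenSystem q d lam μ ℱ N)
    (hlam : ∀ p x, |lam p x| ≤ K) (p : ι) {s : ℝ} (hs : s ∈ Icc t T) :
    Integrable (fun ω => (N p s ω : ℝ) - N p t ω) μ := by
  have h1 := (hN.compensated p).integrable ⟨s, hs⟩
  have h2 : Integrable
      (fun ω => ∫ u in t..s, lam p (pathState q d (fun p s => N p s ω) t u)) μ := by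
    refine Integrable.of_bound (C := K * |s - t|)
      ((hN.measurable_integral_comp_state (lam p) ⟨s, hs⟩).mono (ℱ.le _) le_rfl).aestronglyMeasurable
      (ae_of_all _ fun ω => ?_)
    exact intervalIntegral.norm_integral_le_of_norm_le_const fun u _ => hlam _ _
  refine (h1.add h2).congr (ae_of_all _ fun ω => ?_)
  simp

/-- Compensated increments are orthogonal to bounded functions of the past. -/
lemma integral_mul_compensated_increment [IsProbabilityMeasure μ] (hN : IsStateDrivenSystem q d lam μ ℱ N) (p : ι)
    {a b : ℝ} (ha : a ∈ Icc t T) (hb : b ∈ Icc t T) (hab : a ≤ b) {H : Ω → ℝ} {B : ℝ}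
    (hH : Measurable[ℱ ⟨a, ha⟩] H) (hB : ∀ ω, |H ω| ≤ B) :
    Integrable (fun ω => H ω * (((N p b ω : ℝ) - N p a ω) -
        ∫ u in a..b, lam p (pathState q d (fun p s => N p s ω) t u))) μ ∧
    ∫ ω, H ω * (((N p b ω : ℝ) - N p a ω) -
        ∫ u in a..b, lam p (pathState q d (fun p s => N p s ω) t u)) ∂μ = 0 := by
  simp_rw [hN.compensated_increment p _ ha hb]
  have hM := hN.compensated p
  set Y : Icc t T → Ω → ℝ := fun s ω => ((N p s ω : ℝ) - N p t ω) -
    ∫ u in t..(s : ℝ), lam p (pathState q d (fun p s => N p s ω) t u) with hY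
  have hD : Integrable (Y ⟨b, hb⟩ - Y ⟨a, ha⟩) μ := (hM.integrable _).sub (hM.integrable _)
  have hHD : Integrable (H * (Y ⟨b, hb⟩ - Y ⟨a, ha⟩)) μ :=
    hD.bdd_mul (hH.mono (ℱ.le _) le_rfl).aestronglyMeasurable (ae_of_all _ hB)
  refine ⟨hHD, ?_⟩
  -- Martingale increments have zero conditional expectation, and the bounded factor `H`, known at
  -- time `a`, can be pulled out.
  have h0 : μ[Y ⟨b, hb⟩ - Y ⟨a, ha⟩ | ℱ ⟨a, ha⟩] =ᵐ[μ] 0 := by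
    refine (condExp_sub (hM.integrable _) (hM.integrable _) _).trans ?_
    filter_upwards [hM.condExp_ae_eq (i := ⟨a, ha⟩) (j := ⟨b, hb⟩) hab,
      hM.condExp_ae_eq (i := ⟨a, ha⟩) (j := ⟨a, ha⟩) le_rfl] with ω h1 h2
    simp [h1, h2]
  have h1 := condExp_mul_of_stronglyMeasurable_left hH.stronglyMeasurable hHD hD
  change ∫ ω, (H * (Y ⟨b, hb⟩ - Y ⟨a, ha⟩)) ω ∂μ = 0
  rw [← integral_condExp (ℱ.le ⟨a, ha⟩)]
  refine integral_eq_zero_of_ae ?_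
  filter_upwards [h0, h1] with ω h2 h3
  rw [h3, Pi.mul_apply, h2]; simp

/-- The exponential Dynkin formula. -/
theorem dynkin [IsProbabilityMeasure μ] (hN : IsStateDrivenSystem q d lam μ ℱ N) (h : DynkinData t T K lam r G G')
    {S : ℝ} (hS : S ∈ Ioc t T) :
    ∫ ω, G S (pathState q d (fun p s => N p s ω) t S) *
        expWeight r (pathState q d (fun p s => N p s ω) t) t S ∂μ - G t q =
      ∫ ω, (∫ s in t..S, expWeight r (pathState q d (fun p s => N p s ω) t) t s *
        generatorDrift d lam r G G' s (pathState q d (fun p s => N p s ω) t s)) ∂μ := by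
  have htS : t < S := hS.1
  have hK := h.nonneg
  have hE := (Real.exp_pos (K * (T - t))).le
  have hSI : S ∈ Icc t T := ⟨hS.1.le, hS.2⟩
  have htI : t ∈ Icc t T := ⟨le_rfl, hS.1.le.trans hS.2⟩
  have h' := h.of_le hS.2
  have hpath : ∀ ω p, IsCountingPath t S (fun s => N p s ω) := fun ω p => (hN.path p ω).of_le hS.2
  set X : Ω → ℝ → ℝ := fun ω => pathState q d (fun p s => N p s ω) t with hX
  have hgrid : ∀ {n k : ℕ}, k ≤ n + 1 → gridPt t S n k ∈ Icc t T := fun hk =>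
    ⟨(gridPt_mem htS.le hk).1, (gridPt_mem htS.le hk).2.trans hS.2⟩
  have hw : ∀ ω, ∀ s ∈ Icc t T, |expWeight r (X ω) t s| ≤ Real.exp (K * (T - t)) :=
    fun ω s hs => by
      rw [abs_of_pos (expWeight_pos _ _ _ _)]; exact expWeight_le h.r_le hs
  have hmX : ∀ (g : ℝ → ℝ), ∀ s ∈ Icc t T, Measurable fun ω => g (X ω s) := fun g s hs =>
    (hN.measurable_comp_state g ⟨s, hs⟩ hs.1 le_rfl).mono (ℱ.le _) le_rfl
  have hmw : ∀ s ∈ Icc t T, Measurable fun ω => expWeight r (X ω) t s := fun s hs =>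
    (hN.measurable_expWeight r ⟨s, hs⟩ hs.1 le_rfl).mono (ℱ.le _) le_rfl
  have hmI : ∀ p, ∀ a ∈ Icc t T, ∀ b ∈ Icc t T,
      Measurable fun ω => ∫ u in a..b, lam p (X ω u) := by
    intro p a ha b hb
    have hm : ∀ s (hs : s ∈ Icc t T), Measurable fun ω => ∫ u in t..s, lam p (X ω u) :=
      fun s hs => (hN.measurable_integral_comp_state (lam p) ⟨s, hs⟩).mono (ℱ.le _) le_rfl
    convert (hm b hb).sub (hm a ha) using 1
    funext ω
    have hi : ∀ {c e}, c ∈ Icc t T → e ∈ Icc t T → IntervalIntegrable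
        (fun u => lam p (X ω u)) volume c e := fun hc he =>
      pathState_intervalIntegrable (fun p => hN.path p ω) (lam p) hc he
    simp only [Pi.sub_apply]
    rw [← intervalIntegral.integral_add_adjacent_intervals (hi htI ha) (hi ha hb)]
    ring
  set comp : ℕ → Ω → ℝ := fun n ω => ∑ k ∈ Finset.range (n + 1),
    compensatedStep d lam r G t (X ω) (gridPt t S n k) (gridPt t S n (k + 1)) with hcomp
  set err : ℕ → Ω → ℝ := fun n ω => ∑ k ∈ Finset.range (n + 1),
    jumpError d (fun p s => N p s ω) r G t (X ω) (gridPt t S n k) (gridPt t S n (k + 1)) with herr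
  set mart : ℕ → Ω → ℝ := fun n ω => ∑ k ∈ Finset.range (n + 1), ∑ p,
    expWeight r (X ω) t (gridPt t S n k) *
      (G (gridPt t S n k) (X ω (gridPt t S n k) + d p) -
        G (gridPt t S n k) (X ω (gridPt t S n k))) *
      (((N p (gridPt t S n (k + 1)) ω : ℝ) - N p (gridPt t S n k) ω) -
        ∫ s in gridPt t S n k..gridPt t S n (k + 1), lam p (X ω s)) with hmart
  set C := Real.exp (K * (S - t)) * (K + K * K) +
        Fintype.card ι * (Real.exp (K * (S - t)) * (K + K) * K) with hC
  have hmcomp : ∀ n, AEStronglyMeasurable (comp n) μ := by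
    intro n
    refine Measurable.aestronglyMeasurable (Finset.measurable_fun_sum _ fun k hk => ?_)
    have hk' := Finset.mem_range.1 hk
    have ha := hgrid hk'.le
    have hb : gridPt t S n (k + 1) ∈ Icc t T := hgrid hk'
    refine (((hmX _ _ hb).mul (hmw _ hb)).sub ((hmX (G _) _ hb).mul (hmw _ ha))).add ?_
    exact Finset.measurable_fun_sum _ fun p _ => ((hmw _ ha).mul
      (hmX (fun x => G _ (x + d p) - G _ x) _ ha)).mul (hmI p _ ha _ hb)
  have hmerr : ∀ n, AEStronglyMeasurable (err n) μ := by
    intro n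
    refine Measurable.aestronglyMeasurable (Finset.measurable_fun_sum _ fun k hk => ?_)
    have hk' := Finset.mem_range.1 hk
    have ha := hgrid hk'.le
    have hb : gridPt t S n (k + 1) ∈ Icc t T := hgrid hk'
    refine (hmw _ ha).mul (((hmX (G _) _ hb).sub (hmX (G _) _ ha)).sub ?_)
    exact Finset.measurable_fun_sum _ fun p _ =>
      (hmX (fun x => G _ (x + d p) - G _ x) _ ha).mul
        ((hN.measurable_count p hb).sub (hN.measurable_count p ha))
  have hcompb : ∀ n ω, ‖comp n ω‖ ≤ C * (S - t) := by
    intro n ω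
    have htel : ∑ k ∈ Finset.range (n + 1), C * (gridPt t S n (k + 1) - gridPt t S n k) =
        C * (S - t) := by
      rw [← Finset.mul_sum, Finset.sum_range_sub, gridPt_last, gridPt_zero]
    rw [← htel]
    refine (norm_sum_le _ _).trans (Finset.sum_le_sum fun k hk => ?_)
    have hk' := Finset.mem_range.1 hk
    exact abs_compensatedStep_le h' (hpath ω) (gridPt_mem htS.le hk'.le).1
      (gridPt_mono htS.le n (Nat.le_succ k)) (gridPt_mem htS.le hk').2
  have herrb : ∀ n ω, ‖err n ω‖ ≤
      Real.exp (K * (S - t)) * ((K + K) * 2) * ∑ p, ((N p S ω : ℝ) - N p t ω) := by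
    intro n ω
    have htel : ∑ k ∈ Finset.range (n + 1), Real.exp (K * (S - t)) * ((K + K) * 2) *
        ∑ p, ((N p (gridPt t S n (k + 1)) ω : ℝ) - N p (gridPt t S n k) ω) =
        Real.exp (K * (S - t)) * ((K + K) * 2) * ∑ p, ((N p S ω : ℝ) - N p t ω) := by
      rw [← Finset.mul_sum, Finset.sum_comm]
      congr 1
      refine Finset.sum_congr rfl fun p _ => ?_
      rw [Finset.sum_range_sub (fun k => (N p (gridPt t S n k) ω : ℝ)), gridPt_last, gridPt_zero]
    rw [← htel]
    refine (norm_sum_le _ _).trans (Finset.sum_le_sum fun k hk => ?_)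
    have hk' := Finset.mem_range.1 hk
    exact abs_jumpError_le (v := fun p s => N p s ω) h' (gridPt_mem htS.le hk'.le) fun p =>
      (hpath ω p).mono (gridPt_mem htS.le hk'.le) (gridPt_mem htS.le hk')
        (gridPt_mono htS.le n (Nat.le_succ k))
  have hbint : Integrable (fun ω => Real.exp (K * (S - t)) * ((K + K) * 2) *
      ∑ p, ((N p S ω : ℝ) - N p t ω)) μ :=
    (integrable_finsetSum _ fun p _ => hN.integrable_increment h.lam_le p hSI).const_mul _
  have hmart0 : ∀ n, Integrable (mart n) μ ∧ ∫ ω, mart n ω ∂μ = 0 := by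
    intro n
    have hterm : ∀ k ∈ Finset.range (n + 1), ∀ p : ι, _ := fun k hk p =>
      hN.integral_mul_compensated_increment p (hgrid (n := n) (Finset.mem_range.1 hk).le)
        (hgrid (n := n) (k := k + 1) (Finset.mem_range.1 hk)) (gridPt_mono htS.le n (Nat.le_succ k))
        (H := fun ω => expWeight r (X ω) t (gridPt t S n k) *
          (G (gridPt t S n k) (X ω (gridPt t S n k) + d p) -
            G (gridPt t S n k) (X ω (gridPt t S n k))))
        (B := Real.exp (K * (T - t)) * (K + K))
        ((hN.measurable_expWeight r _ (hgrid (Finset.mem_range.1 hk).le).1 le_rfl).mul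
          (hN.measurable_comp_state (fun x => G _ (x + d p) - G _ x) _
            (hgrid (Finset.mem_range.1 hk).le).1 le_rfl))
        (fun ω => by
          rw [abs_mul]
          exact mul_le_mul (hw ω _ (hgrid (Finset.mem_range.1 hk).le))
            ((abs_sub _ _).trans (add_le_add (h.le _ (hgrid (Finset.mem_range.1 hk).le) _)
              (h.le _ (hgrid (Finset.mem_range.1 hk).le) _))) (abs_nonneg _) hE)
    have hint : ∀ k ∈ Finset.range (n + 1), _ := fun k hk =>
      integrable_finsetSum Finset.univ fun p _ => (hterm k hk p).1
    refine ⟨integrable_finsetSum _ hint, ?_⟩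
    rw [hmart, integral_finsetSum _ hint]
    refine Finset.sum_eq_zero fun k hk => ?_
    rw [integral_finsetSum _ fun p _ => (hterm k hk p).1]
    exact Finset.sum_eq_zero fun p _ => (hterm k hk p).2
  have hcompi : ∀ n, Integrable (comp n) μ := fun n =>
    Integrable.of_bound (hmcomp n) _ (ae_of_all _ (hcompb n))
  have herri : ∀ n, Integrable (err n) μ := fun n =>
    hbint.mono' (hmerr n) (ae_of_all _ (herrb n))
  have hsplit : ∀ n ω, G S (X ω S) * expWeight r (X ω) t S - G t q =
      comp n ω + err n ω + mart n ω := by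
    intro n ω
    have htel := Finset.sum_range_sub (fun k => G (gridPt t S n k) (X ω (gridPt t S n k)) *
      expWeight r (X ω) t (gridPt t S n k)) (n + 1)
    rw [gridPt_last, gridPt_zero, expWeight_start, mul_one] at htel
    have hq : X ω t = q := pathState_start
    rw [hq] at htel
    rw [← htel, hcomp, herr, hmart]
    simp only [← Finset.sum_add_distrib]
    exact Finset.sum_congr rfl fun k _ =>
      increment_eq (v := fun p s => N p s ω) r G lam (X ω) _ _
  have hconst : ∀ n, ∫ ω, comp n ω ∂μ + ∫ ω, err n ω ∂μ =
      ∫ ω, G S (X ω S) * expWeight r (X ω) t S ∂μ - G t q := by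
    intro n
    have hVi : Integrable (fun ω => G S (X ω S) * expWeight r (X ω) t S) μ := by
      refine Integrable.of_bound ((hmX (G S) S hSI).mul (hmw S hSI)).aestronglyMeasurable
        (K * Real.exp (K * (T - t))) (ae_of_all _ fun ω => ?_)
      rw [norm_mul]
      exact mul_le_mul (h.le S hSI _) (hw ω S hSI) (norm_nonneg _) hK
    have h1 : ∫ ω, (G S (X ω S) * expWeight r (X ω) t S - G t q) ∂μ =
        ∫ ω, G S (X ω S) * expWeight r (X ω) t S ∂μ - G t q := by
      rw [integral_sub hVi (integrable_const _)]; simp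
    rw [← h1]
    simp_rw [hsplit n]
    rw [integral_add (f := fun ω => comp n ω + err n ω) ((hcompi n).add (herri n)) (hmart0 n).1,
      integral_add (hcompi n) (herri n),
      (hmart0 n).2, add_zero]
  -- The compensated sums are bounded uniformly in the path and the partition.
  have hlim1 : Tendsto (fun n => ∫ ω, comp n ω ∂μ) atTop (𝓝 (∫ ω, (∫ s in t..S,
      expWeight r (X ω) t s * generatorDrift d lam r G G' s (X ω s)) ∂μ)) :=
    tendsto_integral_of_dominated_convergence (fun _ => C * (S - t)) hmcomp (integrable_const _)
      (fun n => ae_of_all _ (hcompb n))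
      (ae_of_all _ fun ω => tendsto_sum_compensatedStep h' (hpath ω) htS)
  -- On almost every path the errors are exactly zero once the mesh is small, but how small depends
  -- on the path. The total jump count dominates them.
  have hlim2 : Tendsto (fun n => ∫ ω, err n ω ∂μ) atTop (𝓝 (∫ _, (0 : ℝ) ∂μ)) := by
    refine tendsto_integral_of_dominated_convergence _ hmerr hbint
      (fun n => ae_of_all _ (herrb n)) ?_
    filter_upwards [hN.jump] with ω hω
    exact tendsto_const_nhds.congr' ((eventually_sum_jumpError_eq_zero (q := q) (d := d) (r := r)
      (G := G) (v := fun p s => N p s ω) (hpath ω) htS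
      fun s hs => hω s ⟨hs.1, hs.2.trans hS.2⟩).mono fun _ h => h.symm)
  have hlim := hlim1.add hlim2
  simp_rw [hconst] at hlim
  have := tendsto_nhds_unique hlim tendsto_const_nhds
  rw [← this]; simp [hX]

end IsStateDrivenSystem

/-! ### Absorbing sets of the state -/

namespace IsStateDrivenSystem

variable {Ω ι : Type*} [Fintype ι] {t T : ℝ} {q : ℝ} {d : ι → ℝ} {lam : ι → ℝ → ℝ}
  {mΩ : MeasurableSpace Ω} {μ : Measure Ω} {ℱ : Filtration (Icc t T) mΩ}
  {N : ι → ℝ → Ω → ℕ} {K : ℝ}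

/-- Dynkin's formula is applied to the indicator `G` of the complement of `A`, with zero rate. The
drift is nonpositive and `G` vanishes at `q`, so the probability of being outside `A` at time `S` is
at most zero. -/
lemma ae_mem_of_absorbing_at [IsProbabilityMeasure μ] (hN : IsStateDrivenSystem q d lam μ ℱ N)
    (hlam0 : ∀ p x, 0 ≤ lam p x) (hlam : ∀ p x, lam p x ≤ K) (hK : 1 ≤ K) {A : Set ℝ} (hq : q ∈ A)
    (hA : ∀ p, ∀ x ∈ A, lam p x ≠ 0 → x + d p ∈ A) {S : ℝ} (hS : S ∈ Ioc t T) :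
    ∀ᵐ ω ∂μ, pathState q d (fun p s => N p s ω) t S ∈ A := by
  classical
  set G : ℝ → ℝ → ℝ := fun _ x => if x ∈ A then 0 else 1 with hG
  have hG01 : ∀ s x, 0 ≤ G s x ∧ G s x ≤ 1 := fun s x => by
    simp only [hG]; split_ifs <;> norm_num
  have hdata : DynkinData t T K lam (fun _ => 0) G (fun _ _ => 0) :=
    { lam_le := fun p x => by rw [abs_of_nonneg (hlam0 p x)]; exact hlam p x
      r_le := fun x => by rw [abs_zero]; linarith
      le := fun s _ x => by rw [abs_of_nonneg (hG01 s x).1]; exact (hG01 s x).2.trans hK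
      deriv_le := fun s _ x => by rw [abs_zero]; linarith
      hasDeriv := fun x s _ => hasDerivWithinAt_const _ _ _
      deriv_cont := fun x => continuousOn_const }
  have hdyn := hN.dynkin hdata hS
  have hGq : G t q = 0 := by simp [hG, hq]
  have hw : ∀ X s, expWeight (fun _ => 0) X t s = 1 := fun X s => by simp [expWeight]
  simp only [hw, hGq, mul_one, one_mul, sub_zero] at hdyn
  have hle : ∫ ω, G S (pathState q d (fun p s => N p s ω) t S) ∂μ ≤ 0 := by
    rw [hdyn]
    -- Inside `A`, jumps that leave have zero intensity. Outside `A`, the function `G` is already at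
    -- its maximum `1`, so no jump can increase it.
    refine integral_nonpos fun ω => ?_
    simp only [Pi.zero_apply]
    rw [← neg_nonneg, ← intervalIntegral.integral_neg]
    refine intervalIntegral.integral_nonneg hS.1.le fun s _ => ?_
    rw [neg_nonneg, generatorDrift, zero_add, zero_mul, zero_add]
    refine Finset.sum_nonpos fun p _ => ?_
    set x := pathState q d (fun p s => N p s ω) t s
    by_cases hx : x ∈ A
    · by_cases hl : lam p x = 0
      · simp [hl]
      · simp [hG, hx, hA p x hx hl]
    · have : G s x = 1 := by simp [hG, hx]
      rw [this]
      exact mul_nonpos_of_nonneg_of_nonpos (hlam0 p x) (by linarith [(hG01 s (x + d p)).2])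
  have hSI : S ∈ Icc t T := ⟨hS.1.le, hS.2⟩
  have hint : Integrable (fun ω => G S (pathState q d (fun p s => N p s ω) t S)) μ := by
    refine Integrable.of_bound (C := 1) ((hN.measurable_comp_state (G S) ⟨S, hSI⟩ hSI.1
      le_rfl).mono (ℱ.le _) le_rfl).aestronglyMeasurable (ae_of_all _ fun ω => ?_)
    rw [Real.norm_eq_abs, abs_of_nonneg (hG01 S _).1]; exact (hG01 S _).2
  have h0 := (integral_eq_zero_iff_of_nonneg (fun ω => (hG01 S _).1) hint).1
    (le_antisymm hle (integral_nonneg fun ω => (hG01 S _).1))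
  filter_upwards [h0] with ω hω
  by_contra hcon
  simp [hG, hcon] at hω

/-- A set which the state cannot leave by a jump of positive intensity is almost surely never
left. -/
theorem ae_forall_mem_of_absorbing [IsProbabilityMeasure μ]
    (hN : IsStateDrivenSystem q d lam μ ℱ N)
    (hlam0 : ∀ p x, 0 ≤ lam p x) (hlam : ∀ p x, lam p x ≤ K) (hK : 1 ≤ K) {A : Set ℝ} (hq : q ∈ A)
    (hA : ∀ p, ∀ x ∈ A, lam p x ≠ 0 → x + d p ∈ A) :
    ∀ᵐ ω ∂μ, ∀ s ∈ Icc t T, pathState q d (fun p s => N p s ω) t s ∈ A := by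
  -- Countably many times suffice. Before `T` the state agrees with its value at some slightly later
  -- rational time, while `T` has no later time and is treated separately.
  have hQ : ∀ᵐ ω ∂μ, ∀ S : ℚ, (S : ℝ) ∈ Ioc t T →
      pathState q d (fun p s => N p s ω) t S ∈ A :=
    ae_all_iff.2 fun S => by
      by_cases hS : (S : ℝ) ∈ Ioc t T
      · filter_upwards [hN.ae_mem_of_absorbing_at hlam0 hlam hK hq hA hS] with ω hω _ using hω
      · exact ae_of_all _ fun _ h => absurd h hS
  have hT : ∀ᵐ ω ∂μ, t < T → pathState q d (fun p s => N p s ω) t T ∈ A := by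
    by_cases h : t < T
    · filter_upwards [hN.ae_mem_of_absorbing_at hlam0 hlam hK hq hA ⟨h, le_rfl⟩] with ω hω _
      exact hω
    · exact ae_of_all _ fun _ h' => absurd h' h
  filter_upwards [hQ, hT] with ω h1 h2 s hs
  rcases hs.2.lt_or_eq with hlt | heq
  · have hev := pathState_eventually_right (q := q) (d := d) (fun p => hN.path p ω)
      ⟨hs.1, hlt⟩
    obtain ⟨c, hc, hc'⟩ := mem_nhdsGE_iff_exists_Ico_subset.1 hev
    obtain ⟨S, hS1, hS2⟩ := exists_rat_btwn (lt_min (mem_Ioi.1 hc) hlt)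
    have h3 : pathState q d (fun p s => N p s ω) t S = pathState q d (fun p s => N p s ω) t s :=
      hc' ⟨hS1.le, hS2.trans_le (min_le_left _ _)⟩
    rw [← h3]
    exact h1 S ⟨hs.1.trans_lt hS1, (hS2.trans_le (min_le_right _ _)).le⟩
  · rcases hs.1.lt_or_eq with h | h
    · rw [heq]; exact h2 (heq ▸ h)
    · rw [← h, pathState_start]; exact hq

end IsStateDrivenSystem

/-! ### Constants of the market model -/

lemma Side.sum_eq (f : Side → ℝ) : ∑ i : Side, f i = f Side.ask + f Side.bid := by
  change ∑ i ∈ ({Side.ask, Side.bid} : Finset Side), f i = _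
  rw [Finset.sum_pair (by decide)]

namespace MarketModel

variable {n m : ℕ} (M : MarketModel n m)

/-- The only factor whose sign is not immediate is the difference of powers. Since `0 < bCst / aCst
< 1`, the smaller exponent gives the larger power. -/
lemma cHat_pos (j : Fin n × Fin m) : 0 < M.cHat j := by
  have hσ := M.σ_pos
  have hC := M.C_pos
  have hγ := M.γ_pos
  have hη := M.η_pos
  have hω : 0 < 1 - M.ω := sub_pos.2 M.ω_lt_one
  have hb : 0 < M.bCst := div_pos hC hσ
  have hab : 0 < M.aCst - M.bCst := by
    simp only [aCst, bCst, add_sub_cancel_right]; positivity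
  have ha : 0 < M.aCst := by linarith
  have h1 : 1 < 1 + M.σ * M.γ / M.C := by
    have : 0 < M.σ * M.γ / M.C := by positivity
    linarith
  have hx2 : 0 < M.x₂ := by
    have : 0 < 1 - (1 + M.σ * M.γ / M.C)⁻¹ := sub_pos.2 (inv_lt_one_of_one_lt₀ h1)
    simp only [x₂]; positivity
  have hO : 0 < M.oCst j := by
    simp only [oCst]
    exact mul_pos (Real.rpow_pos_of_pos (by linarith) _) (Real.exp_pos _)
  have hpow : 0 < (M.bCst / M.aCst) ^ (M.bCst / (M.aCst - M.bCst)) -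
      (M.bCst / M.aCst) ^ (M.aCst / (M.aCst - M.bCst)) := by
    refine sub_pos.2 (Real.rpow_lt_rpow_of_exponent_gt (div_pos hb ha) ?_ ?_)
    · rw [div_lt_one ha]; linarith
    · exact div_lt_div_of_pos_right (by linarith) hab
  have hx1 : 0 < M.x₁ j := Real.exp_pos _
  refine mul_pos (mul_pos (mul_pos (mul_pos hx2 ?_) hO) hpow) (by positivity)
  exact Real.rpow_pos_of_pos (div_pos hx2 hx1) _

/-! ### The inventory as a state-driven system -/

/-- The displacement of the inventory caused by a trade. -/
def tradeSize (p : (Fin n × Fin m) × Side) : ℝ := -(M.Δ p.1 * p.2.sgn)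

/-- The arrival intensity of trades as a function of the inventory. -/
noncomputable def arrivalRate (R : Fin n × Fin m → ℝ) (p : (Fin n × Fin m) × Side) (x : ℝ) : ℝ :=
  R p.1 * M.allowed p.2 x

/-- The integrand of the representation as a function of the inventory. -/
noncomputable def stateRate (R : Fin n × Fin m → ℝ) (x : ℝ) : ℝ :=
  -M.cTilde * x ^ 2 + ∑ i : Side, ∑ j : Fin n × Fin m, R j * M.allowed i x

lemma allowed_nonneg (i : Side) (x : ℝ) : 0 ≤ M.allowed i x := by
  rw [allowed]; split_ifs <;> norm_num

lemma allowed_le_one (i : Side) (x : ℝ) : M.allowed i x ≤ 1 := by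
  rw [allowed]; split_ifs <;> norm_num

section Inventory

variable {Ω : Type*} {N : Fin n × Fin m → Side → ℝ → Ω → ℕ} {R : Fin n × Fin m → ℝ} {t q : ℝ}

lemma inventory_eq_pathState (s : ℝ) (ω : Ω) : M.inventory t q N s ω =
    pathState q M.tradeSize (fun p s => N p.1 p.2 s ω) t s := by
  rw [inventory, pathState, Fintype.sum_prod_type (fun p : (Fin n × Fin m) × Side =>
    M.tradeSize p * ((N p.1 p.2 s ω : ℝ) - N p.1 p.2 t ω))]
  refine congrArg (q + ·) (Finset.sum_congr rfl fun j _ => ?_)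
  rw [Side.sum_eq]
  simp only [tradeSize, Side.sgn]
  ring

variable {M} [mΩ : MeasurableSpace Ω] {μ : Measure Ω} {ℱ : Filtration (Icc t M.T) mΩ}

lemma IsInventorySystem.isCountingPath (hN : M.IsInventorySystem R t q μ ℱ N)
    (p : (Fin n × Fin m) × Side) (ω : Ω) : IsCountingPath t M.T (fun s => N p.1 p.2 s ω) :=
  ⟨hN.mono _ _ ω, hN.right_cont _ _ ω⟩

lemma IsInventorySystem.ae_leftLim (hN : M.IsInventorySystem R t q μ ℱ N) (ω : Ω) :
    ∀ᵐ s, s ∈ Ioc t M.T → Function.leftLim (fun u => M.inventory t q N u ω) s =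
      pathState q M.tradeSize (fun p s => N p.1 p.2 s ω) t s := by
  simp only [M.inventory_eq_pathState]
  exact pathState_ae_leftLim fun p => hN.isCountingPath p ω

lemma IsInventorySystem.ae_rate (hN : M.IsInventorySystem R t q μ ℱ N) (ω : Ω) :
    ∀ᵐ s, s ∈ Ioc t M.T → M.rate R t q N s ω =
      M.stateRate R (pathState q M.tradeSize (fun p s => N p.1 p.2 s ω) t s) := by
  filter_upwards [hN.ae_leftLim ω] with s hs hsI
  have hs' := hs hsI
  simp only [M.inventory_eq_pathState] at hs'
  simp only [rate, stateRate, intensity, M.inventory_eq_pathState, hs']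

/-- Unit jumps without coincidences give a total count with unit jumps. In the compensator, the left
limit of the inventory may be replaced by its current value, since the two differ only on a Lebesgue
null set of times. -/
lemma IsInventorySystem.isStateDrivenSystem (hN : M.IsInventorySystem R t q μ ℱ N) :
    IsStateDrivenSystem q M.tradeSize (M.arrivalRate R) μ ℱ (fun p => N p.1 p.2) where
  path := hN.isCountingPath
  jump := by
    filter_upwards [hN.no_common_jumps] with ω hω s hs
    set l : (Fin n × Fin m) × Side → ℕ := fun p => Function.leftLim (fun u => N p.1 p.2 u ω) s
      with hl
    have hlim : Function.leftLim (fun u => ∑ p : (Fin n × Fin m) × Side, N p.1 p.2 u ω) s =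
        ∑ p, l p := by
      refine leftLim_eq_of_tendsto (tendsto_const_nhds.congr' ?_)
      filter_upwards [eventually_all.2 fun p => (hN.isCountingPath p ω).eventually_leftLim hs]
        with u hu
      exact Finset.sum_congr rfl fun p _ => (hu p).symm
    rw [hlim]
    by_cases hall : ∀ p : (Fin n × Fin m) × Side, N p.1 p.2 s ω = l p
    · simp [hall]
    · push Not at hall
      obtain ⟨p₀, hp₀⟩ := hall
      rw [← Finset.add_sum_erase _ _ (Finset.mem_univ p₀),
        ← Finset.add_sum_erase _ l (Finset.mem_univ p₀)]
      have h1 : N p₀.1 p₀.2 s ω ≤ l p₀ + 1 := hN.unit_jumps _ _ ω s hs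
      have h2 : ∑ p ∈ Finset.univ.erase p₀, N p.1 p.2 s ω = ∑ p ∈ Finset.univ.erase p₀, l p := by
        refine Finset.sum_congr rfl fun p hp => ?_
        exact (hω s hs p₀.1 p₀.2 p.1 p.2 (Finset.ne_of_mem_erase hp).symm).resolve_left hp₀
      omega
  adapted := fun p s => hN.adapted p.1 p.2 s
  compensated := fun p => by
    convert hN.compensated p.1 p.2 using 3 with s ω
    refine congrArg _ (intervalIntegral.integral_congr_ae ?_)
    filter_upwards [hN.ae_leftLim ω] with u hu huI
    rw [uIoc_of_le s.2.1] at huI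
    rw [intensity, hu ⟨huI.1, huI.2.trans s.2.2⟩, arrivalRate]

end Inventory

/-! ### Bounded solutions, cut off to a compact set of inventories -/

variable {R : Fin n × Fin m → ℝ} {U : ℝ → ℝ → ℝ}

/-- The time derivative of a solution of the linear equation. -/
noncomputable def timeDeriv (R : Fin n × Fin m → ℝ) (U : ℝ → ℝ → ℝ) (s x : ℝ) : ℝ :=
  U s x * M.cTilde * x ^ 2 -
    ∑ i : Side, ∑ j : Fin n × Fin m, R j * U s (x - M.Δ j * i.sgn) * M.allowed i x

variable {M}

lemma IsBoundedSolution.hasDerivWithinAt (hU : M.IsBoundedSolution R U) {s : ℝ}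
    (hs : s ∈ Icc 0 M.T) (x : ℝ) :
    HasDerivWithinAt (fun s => U s x) (M.timeDeriv R U s x) (Icc 0 M.T) s := by
  obtain ⟨dU, h1, h2⟩ := hU.equation s hs x
  have : M.timeDeriv R U s x = dU := by rw [timeDeriv]; linarith
  rwa [this]

/-- Solutions are only assumed differentiable in time. The equation expresses the derivative through
finitely many values of `U`, each continuous in time, so they are `C¹`. -/
lemma IsBoundedSolution.continuousOn_timeDeriv (hU : M.IsBoundedSolution R U) (x : ℝ) :
    ContinuousOn (fun s => M.timeDeriv R U s x) (Icc 0 M.T) := by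
  have hc : ∀ y, ContinuousOn (fun s => U s y) (Icc 0 M.T) := fun y s hs =>
    (hU.hasDerivWithinAt hs y).continuousWithinAt
  refine (((hc x).mul continuousOn_const).mul continuousOn_const).sub ?_
  exact continuousOn_finsetSum _ fun i _ => continuousOn_finsetSum _ fun j _ =>
    (continuousOn_const.mul (hc _)).mul continuousOn_const

/-- An ask trade starts above `-qBar` and lowers the inventory by less than one, so it ends above
`-(qBar + 1) ≥ -L`. It cannot cross `L`, as it moves down. Bid trades are symmetric. -/
lemma abs_le_of_arrivalRate_ne_zero {L : ℝ} (hL : M.qBar + 1 ≤ L) (p : (Fin n × Fin m) × Side)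
    {x : ℝ} (hx : |x| ≤ L) (h : M.arrivalRate R p x ≠ 0) : |x + M.tradeSize p| ≤ L := by
  have hal : M.allowed p.2 x ≠ 0 := right_ne_zero_of_mul h
  rw [allowed] at hal
  have hal' : p.2.sgn * x > -(M.qBar : ℝ) := by by_contra hc; simp [hc] at hal
  have h0 := M.Δ_pos p.1
  have h1 := M.Δ_lt_one p.1
  rw [abs_le] at hx ⊢
  obtain ⟨j, i⟩ := p
  cases i <;> simp only [tradeSize, Side.sgn] at * <;> constructor <;> linarith

/-- A bounded solution cut off outside `[-L, L]`, and its time derivative, satisfy the bounds of the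
exponential Dynkin formula. -/
lemma IsBoundedSolution.exists_dynkinData (hU : M.IsBoundedSolution R U) (hR : ∀ j, 0 < R j)
    {t : ℝ} (ht : t ∈ Icc 0 M.T) (L : ℝ) :
    ∃ K, 1 ≤ K ∧ DynkinData t M.T K (M.arrivalRate R)
      (fun x => if |x| ≤ L then M.stateRate R x else 0)
      (fun s x => if |x| ≤ L then U s x else 0)
      (fun s x => if |x| ≤ L then M.timeDeriv R U s x else 0) := by
  obtain ⟨B, hB⟩ := hU.bounded
  have hB0 : 0 ≤ B := (abs_nonneg _).trans (hB t ht 0)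
  set A : ℝ := ∑ _i : Side, ∑ j : Fin n × Fin m, R j with hA
  have hA0 : 0 ≤ A := Finset.sum_nonneg fun i _ => Finset.sum_nonneg fun j _ => (hR j).le
  have hRA : ∀ j, R j ≤ A := fun j =>
    (Finset.single_le_sum (fun j _ => (hR j).le) (Finset.mem_univ j)).trans
      (Finset.single_le_sum (f := fun _ : Side => ∑ j, R j)
        (fun i _ => Finset.sum_nonneg fun j _ => (hR j).le) (Finset.mem_univ Side.ask))
  have hsub : Icc t M.T ⊆ Icc 0 M.T := Icc_subset_Icc_left ht.1
  have hsq : ∀ {x : ℝ}, |x| ≤ L → |x ^ 2| ≤ L ^ 2 := fun {x} hx => by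
    rw [abs_pow]; exact pow_le_pow_left₀ (abs_nonneg x) hx 2
  have hc0 := abs_nonneg M.cTilde
  have habs : ∀ i x, |M.allowed i x| ≤ 1 := fun i x => by
    rw [abs_of_nonneg (M.allowed_nonneg i x)]; exact M.allowed_le_one i x
  have hrate : ∀ x, |x| ≤ L → |M.stateRate R x| ≤ |M.cTilde| * L ^ 2 + A := by
    intro x hx
    refine (abs_add_le _ _).trans (add_le_add ?_ ?_)
    · rw [abs_mul, abs_neg]; exact mul_le_mul_of_nonneg_left (hsq hx) hc0
    · refine (Finset.abs_sum_le_sum_abs _ _).trans (Finset.sum_le_sum fun i _ =>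
        (Finset.abs_sum_le_sum_abs _ _).trans (Finset.sum_le_sum fun j _ => ?_))
      rw [abs_mul, abs_of_pos (hR j)]
      exact mul_le_of_le_one_right (hR j).le (habs i x)
  have hder : ∀ s ∈ Icc t M.T, ∀ x, |x| ≤ L →
      |M.timeDeriv R U s x| ≤ B * |M.cTilde| * L ^ 2 + A * B := by
    intro s hs x hx
    refine (abs_sub _ _).trans (add_le_add ?_ ?_)
    · rw [abs_mul, abs_mul]
      exact mul_le_mul (mul_le_mul_of_nonneg_right (hB s (hsub hs) x) hc0) (hsq hx) (abs_nonneg _)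
        (by positivity)
    · rw [hA, Finset.sum_mul]
      refine (Finset.abs_sum_le_sum_abs _ _).trans (Finset.sum_le_sum fun i _ => ?_)
      rw [Finset.sum_mul]
      refine (Finset.abs_sum_le_sum_abs _ _).trans (Finset.sum_le_sum fun j _ => ?_)
      rw [abs_mul, abs_mul, abs_of_pos (hR j)]
      exact (mul_le_of_le_one_right (mul_nonneg (hR j).le (abs_nonneg _)) (habs i x)).trans
        (mul_le_mul_of_nonneg_left (hB s (hsub hs) _) (hR j).le)
  have p1 : 0 ≤ |M.cTilde| * L ^ 2 := by positivity
  have p2 : 0 ≤ B * |M.cTilde| * L ^ 2 := by positivity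
  have p3 : 0 ≤ A * B := by positivity
  -- The sum of all the bounds serves as one constant. The summand `1` provides `1 ≤ K`, which the
  -- absorbing-set argument needs to dominate an indicator.
  refine ⟨1 + A + B + (|M.cTilde| * L ^ 2 + A) + (B * |M.cTilde| * L ^ 2 + A * B), by linarith,
    { lam_le := fun p x => ?_, r_le := fun x => ?_, le := fun s hs x => ?_,
      deriv_le := fun s hs x => ?_, hasDeriv := fun x s hs => ?_, deriv_cont := fun x => ?_ }⟩
  · rw [arrivalRate, abs_mul, abs_of_pos (hR _)]
    have := mul_le_of_le_one_right (hR p.1).le (habs p.2 x)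
    linarith [hRA p.1]
  · split_ifs with hx
    · linarith [hrate x hx]
    · rw [abs_zero]; linarith
  · split_ifs with hx
    · linarith [hB s (hsub hs) x]
    · rw [abs_zero]; linarith
  · split_ifs with hx
    · linarith [hder s hs x hx]
    · rw [abs_zero]; linarith
  · split_ifs with hx
    · exact (hU.hasDerivWithinAt (hsub hs) x).mono hsub
    · exact hasDerivWithinAt_const _ _ _
  · split_ifs with hx
    · exact (hU.continuousOn_timeDeriv x).mono hsub
    · exact continuousOn_const

/-- The linear equation says that the drift of the cut-off solution vanishes on `[-L, L]`. -/
lemma generatorDrift_eq_zero {L : ℝ} (hL : M.qBar + 1 ≤ L) (s : ℝ) {x : ℝ} (hx : |x| ≤ L) :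
    generatorDrift M.tradeSize (M.arrivalRate R)
      (fun x => if |x| ≤ L then M.stateRate R x else 0)
      (fun s x => if |x| ≤ L then U s x else 0)
      (fun s x => if |x| ≤ L then M.timeDeriv R U s x else 0) s x = 0 := by
  simp only [generatorDrift, if_pos hx]
  have h1 : ∀ p, M.arrivalRate R p x *
      ((if |x + M.tradeSize p| ≤ L then U s (x + M.tradeSize p) else 0) - U s x) =
      R p.1 * U s (x - M.Δ p.1 * p.2.sgn) * M.allowed p.2 x -
        R p.1 * M.allowed p.2 x * U s x := by
    intro p
    -- The cut-off at the target matters only if the trade leaves `[-L, L]`, and then the intensity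
    -- is zero and both sides vanish.
    by_cases h : M.arrivalRate R p x = 0
    · have h' : R p.1 * M.allowed p.2 x = 0 := h
      rw [h, zero_mul, h', mul_right_comm, h']; ring
    · rw [if_pos (abs_le_of_arrivalRate_ne_zero hL p hx h), tradeSize, ← sub_eq_add_neg, arrivalRate]
      ring
  simp_rw [h1]
  rw [Finset.sum_sub_distrib, Fintype.sum_prod_type_right, Fintype.sum_prod_type_right,
    timeDeriv, stateRate, add_mul]
  simp only [Finset.sum_mul]
  ring

/-! ### The representation formula -/

variable {Ω : Type*} {N : Fin n × Fin m → Side → ℝ → Ω → ℕ} {t q : ℝ}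
  [mΩ : MeasurableSpace Ω] {μ : Measure Ω} {ℱ : Filtration (Icc t M.T) mΩ}

lemma IsInventorySystem.intervalIntegrable_rate (hN : M.IsInventorySystem R t q μ ℱ N)
    (ht : t ≤ M.T) (ω : Ω) :
    IntervalIntegrable (fun s => M.rate R t q N s ω) volume t M.T := by
  refine (pathState_intervalIntegrable (q := q) (d := M.tradeSize)
    (fun p => hN.isCountingPath p ω) (M.stateRate R) ⟨le_rfl, ht⟩ ⟨ht, le_rfl⟩).congr_ae ?_
  rw [uIoc_of_le ht, EventuallyEq, ae_restrict_iff' measurableSet_Ioc]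
  filter_upwards [hN.ae_rate ω] with s hs hsI using (hs hsI).symm

theorem IsInventorySystem.feynmanKac [IsProbabilityMeasure μ]
    (hN : M.IsInventorySystem R t q μ ℱ N) (hR : ∀ j, 0 < R j) (hU : M.IsBoundedSolution R U)
    (ht : t ∈ Icc 0 M.T) :
    Integrable (fun ω => Real.exp (∫ s in t..M.T, M.rate R t q N s ω)) μ ∧
      U t q = ∫ ω, Real.exp (∫ s in t..M.T, M.rate R t q N s ω) ∂μ := by
  -- At `t = T` both sides are `1`. Dynkin's formula is stated for a nondegenerate interval.
  rcases ht.2.eq_or_lt with heq | hlt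
  · simp [heq, hU.terminal]
  have hS := hN.isStateDrivenSystem
  -- Large enough both to contain the starting point and to be absorbing.
  set L : ℝ := |q| + M.qBar + 1 with hLdef
  have hqL : |q| ≤ L := by have : (0 : ℝ) ≤ M.qBar := Nat.cast_nonneg _; linarith
  have hL : M.qBar + 1 ≤ L := by linarith [abs_nonneg q]
  obtain ⟨K, hK, hdata⟩ := hU.exists_dynkinData hR ht L
  set r : ℝ → ℝ := fun x => if |x| ≤ L then M.stateRate R x else 0 with hr
  have hconf := hS.ae_forall_mem_of_absorbing (A := {x | |x| ≤ L})
    (fun p x => mul_nonneg (hR p.1).le (M.allowed_nonneg p.2 x))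
    (fun p x => (le_abs_self _).trans (hdata.lam_le p x)) hK hqL
    (fun p x hx h => abs_le_of_arrivalRate_ne_zero hL p hx h)
  have hTI : M.T ∈ Icc t M.T := ⟨hlt.le, le_rfl⟩
  -- On confined paths the cut-off rate is the true rate, up to a null set of times.
  have hweight : ∀ᵐ ω ∂μ, expWeight r (pathState q M.tradeSize (fun p s => N p.1 p.2 s ω) t) t M.T =
      Real.exp (∫ s in t..M.T, M.rate R t q N s ω) := by
    filter_upwards [hconf] with ω hω
    refine congrArg Real.exp (intervalIntegral.integral_congr_ae ?_)
    filter_upwards [hN.ae_rate ω] with s hs hsI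
    rw [uIoc_of_le hlt.le] at hsI
    rw [hs hsI, hr]
    exact if_pos (hω s ⟨hsI.1.le, hsI.2⟩)
  have hint : Integrable
      (fun ω => expWeight r (pathState q M.tradeSize (fun p s => N p.1 p.2 s ω) t) t M.T) μ := by
    refine Integrable.of_bound (C := Real.exp (K * (M.T - t)))
      ((hS.measurable_expWeight r ⟨M.T, hTI⟩ hlt.le le_rfl).mono
        (ℱ.le _) le_rfl).aestronglyMeasurable (ae_of_all _ fun ω => ?_)
    rw [Real.norm_eq_abs, abs_of_pos (expWeight_pos _ _ _ _)]
    exact expWeight_le hdata.r_le hTI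
  refine ⟨hint.congr hweight, ?_⟩
  have hdyn := hS.dynkin hdata ⟨hlt, le_rfl⟩
  have hzero : ∫ ω, (∫ s in t..M.T,
      expWeight r (pathState q M.tradeSize (fun p s => N p.1 p.2 s ω) t) t s *
      generatorDrift M.tradeSize (M.arrivalRate R) r
        (fun s x => if |x| ≤ L then U s x else 0)
        (fun s x => if |x| ≤ L then M.timeDeriv R U s x else 0) s
        (pathState q M.tradeSize (fun p s => N p.1 p.2 s ω) t s)) ∂μ = 0 := by
    refine integral_eq_zero_of_ae ?_
    filter_upwards [hconf] with ω hω
    refine intervalIntegral.integral_zero_ae (ae_of_all _ fun s hs => ?_)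
    rw [uIoc_of_le hlt.le] at hs
    rw [generatorDrift_eq_zero hL s (hω s ⟨hs.1.le, hs.2⟩), mul_zero]
  rw [hzero, sub_eq_zero] at hdyn
  simp only [if_pos hqL] at hdyn
  rw [← hdyn]
  refine integral_congr_ae ?_
  filter_upwards [hweight, hconf] with ω h1 h2
  have h3 : |pathState q M.tradeSize (fun p s => N p.1 p.2 s ω) t M.T| ≤ L := h2 _ hTI
  rw [if_pos h3, hU.terminal, one_mul, h1]

end MarketModel

theorem lemma3p2 {n m : ℕ} (M : MarketModel n m) :
    (∀ j, 0 < M.cHat j) ∧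
    -- the representation, for every positive family `R`, in particular for `R = M.cHat`
    ∀ R : Fin n × Fin m → ℝ, (∀ j, 0 < R j) →
      ∀ U : ℝ → ℝ → ℝ, M.IsBoundedSolution R U →
      ∀ t ∈ Set.Icc 0 M.T, ∀ q : ℝ,
      ∀ (Ω : Type*) [mΩ : MeasurableSpace Ω] (μ : MeasureTheory.Measure Ω)
        [MeasureTheory.IsProbabilityMeasure μ]
        (ℱ : MeasureTheory.Filtration (Set.Icc t M.T) mΩ)
        (N : Fin n × Fin m → Side → ℝ → Ω → ℕ),
        M.IsInventorySystem R t q μ ℱ N →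
        (∀ ω, IntervalIntegrable (fun s => M.rate R t q N s ω) MeasureTheory.volume t M.T) ∧
        MeasureTheory.Integrable (fun ω => Real.exp (∫ s in t..M.T, M.rate R t q N s ω)) μ ∧
        U t q = ∫ ω, Real.exp (∫ s in t..M.T, M.rate R t q N s ω) ∂μ := by
  refine ⟨M.cHat_pos, fun R hR U hU t ht q Ω _ μ _ ℱ N hN => ?_⟩
  exact ⟨hN.intervalIntegrable_rate ht.2, hN.feynmanKac hR hU ht⟩
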